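/- **Conventions.** $\widehat{\mathbb R}^3=\mathbb R^3\cup\{\infty\}$; a circle is a proper circle or a straight line together with $\infty$. A quadrilateral $(a,b,c,d)$ is *embedded* if $a,b,c,d\in\mathbb R^3$ are distinct points of a circle on which $a,c$ are separated by $b,d$. The vertices of a combinatorial cube are denoted $x,x_i,x_{ij},x_{123}$. A *spherical cube* is an elementary hexahedron of a circular net, i.e. eight points such that the four vertices of each of the six faces lie on a circle. A *cyclidic cube* is an elementary hexahedron of a 3D cyclidic net in $\mathbb R^3$, i.e. a spherical cube in $\mathbb R^3$ with embedded face quadrilaterals together with an orthonormal 3-frame $B=(t^{(1)},t^{(2)},t^{(3)})$ at each vertex, such that for each edge of direction $i$, from a vertex $y$ to $y_i$, the frame at $y_i$ is obtained from the frame at $y$ by replacing $t^{(i)}$ by $-t^{(i)}$ and reflecting in the perpendicular bisecting plane of $y$ and $y_i$. A *cyclidic patch* is the restriction to a closed rectangle of a curvature line parametrization of a Dupin cyclide (given in the projective model of Lie geometry by a pair of polar planes of signature $(++-)$, circles excluded), or, in the degenerate case of a *spherical patch*, a piece of a sphere or plane parametrized over a rectangle by circular arcs from a pair of orthogonal pencils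 of circles. Patches may contain singular points, unless said otherwise. A patch with vertices $(x,x_j,x_{jk},x_k)$ is the *face* $f^{(i)}$ at $x$ of a cyclidic cube ($\{i,j,k\}=\{1,2,3\}$) if these are the vertices of the corresponding face of the cube and the unit tangent vectors at $x$ of its boundary arcs towards $x_j$ and $x_k$ are the vectors $t^{(j)},t^{(k)}$ of the frame of the cube at $x$ (so that its normal at $x$ is $t^{(i)}$ up to orientation). **Proposition.** Let a spherical cube in $\mathbb R^3$ with embedded face quadrilaterals be given. For each of its vertices $v$, assigning to a cyclidic cube its frame at $v$ is a bijection, indeed a homeomorphism, from the space of all cyclidic cubes with the given vertices onto the space of all orthonormal 3-frames of $\mathbb R^3$. This is a 3-parameter family: every cyclidic cube in this space has a neighbourhood homeomorphic to an open subset of $\mathbb R^3$. **Corollary.** Let $f^{(1)},f^{(2)},f^{(3)}$ be cyclidic patches, where $f^{(i)}$ has the vertices $(x,x_j,x_{jk},x_k)$, $(i,j,k)$ a cyclic permutation of $(1,2,3)$, such that these are four distinct points of $\mathbb R^3$ that are non-singular points of $f^{(i)}$, and such that for each $k$ the two patches meeting along the edge from $x$ to $x_k$ have the same boundary arc there. Assume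 that the seven points $x,x_i,x_{ij}$ do not all lie on one circle. Then there is exactly one point $x_{123}\in\widehat{\mathbb R}^3$ such that $(x_i,x_{ij},x_{123},x_{ik})$ lie on a circle for each $i$, where $\{i,j,k\}=\{1,2,3\}$. If $x_{123}\in\mathbb R^3$ and the six face quadrilaterals are embedded (as the definition of a cyclidic cube requires), then there is exactly one cyclidic cube that has $f^{(1)},f^{(2)},f^{(3)}$ as its three faces at $x$. -/

import Mathlib

noncomputable section

namespace Cyclidic

open Filter Topology

/-! ## The compactified Euclidean space and its circles -/

/-- Euclidean 3-space. -/
abbrev E3 := EuclideanSpace ℝ (Fin 3)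

/-- Compactified Euclidean 3-space `ℝ³ ∪ {∞}`. -/
abbrev E3hat := OnePoint E3

/-- A (generalized) circle of `ℝ³ ∪ {∞}`: a proper circle of positive radius,
or a straight line together with `∞`. -/
def IsCircle (K : Set E3hat) : Prop :=
  (∃ (A : AffineSubspace ℝ E3) (c : E3) (r : ℝ), Module.finrank ℝ A.direction = 2 ∧ c ∈ A ∧
      0 < r ∧ K = (fun p : E3 => (p : E3hat)) '' {p | p ∈ A ∧ dist p c = r}) ∨
    ∃ A : AffineSubspace ℝ E3, Module.finrank ℝ A.direction = 1 ∧
      K = insert OnePoint.infty ((fun p : E3 => (p : E3hat)) '' {p | p ∈ A})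

/-- The points of `S` lie on a common circle. -/
def Concircular (S : Set E3hat) : Prop := ∃ K, IsCircle K ∧ S ⊆ K

/-- The quadrilateral `(a, b, c, d)` is circular and embedded: its vertices are four distinct
points of a circle `K`, and `a`, `c` are separated on `K` by `b`, `d`, that is, no connected
subset of `K \ {b, d}` contains both `a` and `c`. -/
def IsEmbeddedQuad (a b c d : E3) : Prop :=
  [a, b, c, d].Nodup ∧
    ∃ K : Set E3hat, IsCircle K ∧ {(a : E3hat), (b : E3hat), (c : E3hat), (d : E3hat)} ⊆ K ∧
      ∀ J : Set E3hat, J ⊆ K \ {(b : E3hat), (d : E3hat)} → IsPreconnected J →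
        ¬ ((a : E3hat) ∈ J ∧ (c : E3hat) ∈ J)

/-! ## Spherical cubes and cyclidic cubes

The vertices of a combinatorial cube are indexed by the subsets of the set of the three coordinate
directions: `X ∅`, `X {i}`, `X {i, j}`, `X univ` are the points `x`, `x_i`, `x_ij`, `x_123`. -/

/-- The index set of the vertices of a cube. -/
abbrev CubeVertex := Finset (Fin 3)

/-- A spherical cube: an elementary hexahedron of a circular net, i.e. the vertices of each of the
six faces lie on a circle. -/
def IsSphericalCube (X : CubeVertex → E3) : Prop :=
  ∀ (S : CubeVertex) (i j : Fin 3), i ∉ S → j ∉ S → i ≠ j →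
    Concircular {(X S : E3hat), (X (insert i S) : E3hat),
      (X (insert i (insert j S)) : E3hat), (X (insert j S) : E3hat)}

/-- All six face quadrilaterals of the cube are embedded. -/
def HasEmbeddedFaces (X : CubeVertex → E3) : Prop :=
  ∀ (S : CubeVertex) (i j : Fin 3), i ∉ S → j ∉ S → i ≠ j →
    IsEmbeddedQuad (X S) (X (insert i S)) (X (insert i (insert j S))) (X (insert j S))

/-- The action on vectors of the reflection in the perpendicular bisecting plane of `x` and `y`. -/
def bisectorReflection (x y v : E3) : E3 :=
  v - (2 * (inner ℝ (y - x) v / inner ℝ (y - x) (y - x))) • (y - x)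

/-- A cyclidic cube: an elementary hexahedron of a 3D cyclidic net in `ℝ³`. It consists of the
eight vertices `X` of a circular net with embedded quadrilaterals and of an orthonormal 3-frame
`B S = (t⁽¹⁾, t⁽²⁾, t⁽³⁾)` at each vertex `X S`, such that the frames at the two end points of an
edge of direction `i` are related by reversing `t⁽ⁱ⁾` and reflecting in the perpendicular
bisecting plane of the edge. -/
structure IsCyclidicCube (X : CubeVertex → E3) (B : CubeVertex → Fin 3 → E3) : Prop where
  spherical : IsSphericalCube X
  embedded : HasEmbeddedFaces X
  orthonormal : ∀ S, Orthonormal ℝ (B S)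
  evolution : ∀ (S : CubeVertex) (i : Fin 3), i ∉ S → ∀ k : Fin 3,
    B (insert i S) k =
      bisectorReflection (X S) (X (insert i S)) (if k = i then -B S k else B S k)

/-- The space of all cyclidic cubes with given vertices, topologized by the frame vectors. -/
def CyclidicCubesOn (X : CubeVertex → E3) : Set (CubeVertex → Fin 3 → E3) :=
  {B | IsCyclidicCube X B}

/-- The space of all orthonormal 3-frames of `ℝ³`. -/
def OrthonormalFrames : Set (Fin 3 → E3) := {t | Orthonormal ℝ t}

/-! ## The projective model of Lie geometry -/

/-- Homogeneous coordinates of Lie geometry: `(v, a, b, r)` stands for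
`v + a e₀ + b e_∞ + r e_r`. -/
abbrev LieVec := E3 × ℝ × ℝ × ℝ

/-- The inner product of signature `(4, 2)` on homogeneous coordinates; here
`⟨e₀, e₀⟩ = ⟨e_∞, e_∞⟩ = 0`, `⟨e₀, e_∞⟩ = -1/2` and `⟨e_r, e_r⟩ = -1`. -/
def lieForm (u w : LieVec) : ℝ :=
  inner ℝ u.1 w.1 - (u.2.1 * w.2.2.1 + u.2.2.1 * w.2.1) / 2 - u.2.2.2 * w.2.2.2

/-- The basis vector `e_r`; the last coordinate of a vector is its `e_r`-component, and point
spheres are the points of the Lie quadric whose `e_r`-component vanishes. -/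
def eR : LieVec := (0, 0, 0, 1)

/-- Homogeneous coordinates of the points of `ℝ³ ∪ {∞}`: `x + e₀ + ‖x‖² e_∞`, and `e_∞`. -/
def pointRep (p : E3hat) : LieVec :=
  p.elim (0, 0, 1, 0) fun x => (x, 1, ‖x‖ ^ 2, 0)

/-- `P` is (the linear span of) a projective plane of signature `(++-)`. -/
def IsCyclidicPlane (P : Submodule ℝ LieVec) : Prop :=
  ∃ u v w : LieVec, P = Submodule.span ℝ {u, v, w} ∧
    lieForm u u = 1 ∧ lieForm v v = 1 ∧ lieForm w w = -1 ∧
    lieForm u v = 0 ∧ lieForm u w = 0 ∧ lieForm v w = 0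

/-- A Dupin cyclide: a pair of polar planes of signature `(++-)`, whose intersections with the Lie
quadric are the two enveloping families of oriented spheres. Circles are excluded: neither family
consists of point spheres only. -/
structure IsDupinCyclide (P Q : Submodule ℝ LieVec) : Prop where
  left : IsCyclidicPlane P
  right : IsCyclidicPlane Q
  polar : ∀ w, w ∈ Q ↔ ∀ u ∈ P, lieForm u w = 0
  left_not_points : ∃ u ∈ P, u.2.2.2 ≠ 0
  right_not_points : ∃ u ∈ Q, u.2.2.2 ≠ 0

/-- `a 0, a 1, a 2` represent three distinct spheres of the family given by the plane `P`, i.e.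
three distinct points of the intersection of `P` with the Lie quadric. -/
def AreSpheresOf (P : Submodule ℝ LieVec) (a : Fin 3 → LieVec) : Prop :=
  (∀ i, a i ∈ P ∧ a i ≠ 0 ∧ lieForm (a i) (a i) = 0) ∧
    ∀ i j, i ≠ j → LinearIndependent ℝ ![a i, a j]

/-- The quadratic parametrization of the conic through `a 0`, `a 1`, `a 2` (for the parameters
`0`, `1/2`, `1`) in homogeneous coordinates. -/
def conicParam (a : Fin 3 → LieVec) (t : ℝ) : LieVec :=
  (lieForm (a 1) (a 2) * (2 * t ^ 2 - 3 * t + 1)) • a 0 +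
    (lieForm (a 0) (a 2) * (t - t ^ 2)) • a 1 +
    (lieForm (a 0) (a 1) * (2 * t ^ 2 - t)) • a 2

/-! ## Cyclidic patches -/

/-- Parametrized surface patches in `ℝ³ ∪ {∞}`. -/
abbrev Patch := unitInterval → unitInterval → E3hat

/-- A patch of a Dupin cyclide: a curvature line parametrization of a Dupin cyclide, restricted to
a closed rectangle. The point `f s t` is the contact point of the sphere with parameter `s` of the
first family and the sphere with parameter `t` of the second family, i.e. the point sphere in the
contact element that they span. -/
def IsDupinPatch (f : Patch) : Prop :=
  ∃ P Q : Submodule ℝ LieVec, IsDupinCyclide P Q ∧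
    ∃ a b : Fin 3 → LieVec, AreSpheresOf P a ∧ AreSpheresOf Q b ∧
      ∀ s t : unitInterval,
        pointRep (f s t) ∈ Submodule.span ℝ {conicParam a s, conicParam b t}

/-- Möbius transformations: the Lie sphere transformations preserving the point spheres. -/
def IsMoebius (M : E3hat → E3hat) : Prop :=
  ∃ T : LieVec ≃ₗ[ℝ] LieVec, (∀ u w, lieForm (T u) (T w) = lieForm u w) ∧ T eR = eR ∧
    ∀ p, pointRep (M p) ∈ Submodule.span ℝ {T (pointRep p)}

/-- Cartesian coordinates on the plane `z = 0` with `∞`. Each coordinate may become infinite. -/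
def cartesian (u v : OnePoint ℝ) : E3hat :=
  u.elim OnePoint.infty fun a => v.elim OnePoint.infty fun b => ((!₂[a, b, 0] : E3) : E3hat)

/-- Polar coordinates on the plane `z = 0` with `∞`. The coordinate `ρ` runs through the whole line
of angle `θ`, i.e. it may be negative or infinite. -/
def polar (ρ : OnePoint ℝ) (θ : ℝ) : E3hat :=
  ρ.elim OnePoint.infty fun r => ((!₂[r * Real.cos θ, r * Real.sin θ, 0] : E3) : E3hat)

/-- A Möbius image of a coordinate rectangle of the Cartesian coordinates; both families of
coordinate lines are pencils of touching circles. -/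
def IsCartesianPatch (f : Patch) : Prop :=
  ∃ (M : E3hat → E3hat) (u v : unitInterval → OnePoint ℝ), IsMoebius M ∧
    Continuous u ∧ Function.Injective u ∧ Continuous v ∧ Function.Injective v ∧
    ∀ s t, f s t = M (cartesian (u s) (v t))

/-- A Möbius image of a coordinate rectangle of the polar coordinates; the coordinate lines are the
circles through two points and the circles orthogonal to them. -/
def IsPolarPatch (f : Patch) : Prop :=
  ∃ (M : E3hat → E3hat) (ρ : unitInterval → OnePoint ℝ) (θ : unitInterval → ℝ), IsMoebius M ∧
    Continuous ρ ∧ Function.Injective ρ ∧ Continuous θ ∧ Function.Injective θ ∧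
    |θ 1 - θ 0| < 2 * Real.pi ∧
    ∀ s t, f s t = M (polar (ρ s) (θ t))

/-- A spherical patch: a piece of a sphere (or plane), parametrized by circular arcs from a pair of
orthogonal one-parameter families (pencils) of circles on the sphere. Up to Möbius transformations
and the order of the families there are two such pairs. -/
def IsSphericalPatch (f : Patch) : Prop :=
  IsCartesianPatch f ∨ IsPolarPatch f ∨ IsPolarPatch fun s t => f t s

/-- Cyclidic patches, where spherical patches are considered as degenerate cyclidic patches. -/
def IsCyclidicPatch (f : Patch) : Prop := IsDupinPatch f ∨ IsSphericalPatch f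

/-- The vertices of the patch are non-singular points. A point of a cyclidic patch is singular if
and only if the parametrization is constant along one of the parameter lines through it. -/
def HasNonsingularVertices (f : Patch) : Prop :=
  (∃ s, f s 0 ≠ f 0 0) ∧ (∃ s, f s 1 ≠ f 0 1) ∧ (∃ t, f 0 t ≠ f 0 0) ∧ ∃ t, f 1 t ≠ f 1 0

/-- The Euclidean point of a finite point of `ℝ³ ∪ {∞}` (and `0` for `∞`). -/
def finitePart (p : E3hat) : E3 := p.elim 0 id

/-- `t` is the unit tangent vector of the curve `γ` at its initial point `x`, a finite point,
directed along the curve. -/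
def IsInitialTangent (γ : unitInterval → E3hat) (t : E3) : Prop :=
  ∃ x : E3, γ 0 = (x : E3hat) ∧ ContinuousAt γ 0 ∧ ‖t‖ = 1 ∧
    Tendsto (fun s => ‖finitePart (γ s) - x‖⁻¹ • (finitePart (γ s) - x)) (𝓝[>] 0) (𝓝 t)

/-! ## Three patches at a common vertex

`f i` is the patch opposite to direction `i`; its two parameter directions are `i + 1` and `i + 2`
(modulo 3). -/

/-- The three cyclidic patches `f 0`, `f 1`, `f 2` share the vertex `x = X ∅` and, pairwise, a
boundary arc emanating from it, with the combinatorics of the three faces of a cube at a vertex.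
The patch `f i` has the vertices `(x, x_j, x_jk, x_k)` with `j = i + 1`, `k = i + 2`; these are four
distinct non-singular points. The value `X univ` is irrelevant. -/
structure AreThreeFaces (f : Fin 3 → Patch) (X : CubeVertex → E3) : Prop where
  patch : ∀ i, IsCyclidicPatch (f i)
  nonsingular : ∀ i, HasNonsingularVertices (f i)
  vertex : ∀ i, f i 0 0 = (X ∅ : E3hat)
  vertex_left : ∀ i, f i 1 0 = (X {i + 1} : E3hat)
  vertex_opposite : ∀ i, f i 1 1 = (X {i + 1, i + 2} : E3hat)
  vertex_right : ∀ i, f i 0 1 = (X {i + 2} : E3hat)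
  distinct : ∀ i, [X ∅, X {i + 1}, X {i + 1, i + 2}, X {i + 2}].Nodup
  arc : ∀ i, Set.range (fun t => f i 0 t) = Set.range (fun s => f (i + 1) s 0)

/-- The point `p` completes the seven vertices `X S`, `S ≠ univ`, to a spherical cube: it is
concircular with each triple `(x_i, x_ij, x_ik)`. -/
def IsEighthVertex (X : CubeVertex → E3) (p : E3hat) : Prop :=
  ∀ i : Fin 3, Concircular {(X {i} : E3hat), (X {i, i + 1} : E3hat), p, (X {i, i + 2} : E3hat)}

/-- The patches `f i` are the three faces at the vertex `X ∅` of the cyclidic cube `(X, B)`: `f i`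
has the vertices of the face, and its vertex frame at `X ∅` consists of the vectors `t⁽ʲ⁾`, `t⁽ᵏ⁾`
of the frame `B ∅` as the tangent vectors of the boundary arcs (`j = i + 1`, `k = i + 2`), and
hence of `t⁽ⁱ⁾` as the normal vector, up to orientation. -/
structure IsCubeWithFaces (f : Fin 3 → Patch) (X : CubeVertex → E3)
    (B : CubeVertex → Fin 3 → E3) : Prop where
  cube : IsCyclidicCube X B
  vertex : ∀ i, f i 0 0 = (X ∅ : E3hat)
  vertex_left : ∀ i, f i 1 0 = (X {i + 1} : E3hat)
  vertex_opposite : ∀ i, f i 1 1 = (X {i + 1, i + 2} : E3hat)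
  vertex_right : ∀ i, f i 0 1 = (X {i + 2} : E3hat)
  tangent_left : ∀ i, IsInitialTangent (fun s => f i s 0) (B ∅ (i + 1))
  tangent_right : ∀ i, IsInitialTangent (fun t => f i 0 t) (B ∅ (i + 2))

end Cyclidic

end

noncomputable section

namespace Cyclidic

open Filter Topology

/-! ## Reflections in bisecting planes -/

/-! The proposition is a statement about trivial holonomy. The frame rule along an edge is an
involution of triples of vectors (`edgeMap`) preserving orthonormality, so the frame at one vertex
determines all others, and every initial frame occurs provided that the rule commutes around each
face. Sign changes commute with linear reflections, so only the four bisector reflections of a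
circular quadrilateral matter (`bisectorReflection_comm`). On a proper circle their composite has
determinant 1 and fixes both the normal of the plane of the circle and the radius vector at the
initial vertex, hence is the identity; on a line all four linear reflections coincide.
`exists_transport` integrates the commuting edge maps over the cube. The space of orthonormal frames
is charted by the Cayley transform to skew-symmetric matrices.

The corollary needs the eighth vertex and a frame. Circles correspond to three-dimensional subspaces
spanned by point representatives. With respect to the representatives of `x`, `x_1`, `x_2`, `x_3`,
three linear equations in four unknowns put a vector into the spans of all three remaining face
circles, and every solution is automatically isotropic, hence a point; this is Miquel's theorem
(`exists_eighth`). Two different solutions would force two of the points `x_ij` to coincide.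

For the frame, every patch, near its initial vertex and at its four vertices, is a translation
surface `A(s) + B(t)` in homogeneous coordinates, with Lie-orthogonal derivatives of `A` and `B`.
For Dupin cyclides this comes from scaling the enveloping spheres to `e_r`-component 1 and
subtracting, for polar coordinates from dividing by the radius. The translation form yields at once
that the four vertices are concircular and that the initial tangents are orthogonal
(`HasCornerGeometry`). Patches sharing an arc share its tangent, so the three tangents at `x` form
an orthonormal frame, to which the proposition applies. -/

lemma bisectorReflection_eq_reflection (x y v : E3) :
    bisectorReflection x y v = (Submodule.span ℝ {y - x})ᗮ.reflection v := by
  rw [Submodule.reflection_orthogonal_apply, Submodule.reflection_singleton_apply,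
    bisectorReflection, real_inner_self_eq_norm_sq]
  simp only [RCLike.ofReal_real_eq_id, id]
  module

lemma bisectorReflection_involutive (x y : E3) :
    Function.Involutive (bisectorReflection x y) := by
  intro v
  simp only [bisectorReflection_eq_reflection, Submodule.reflection_reflection]

lemma inner_bisectorReflection (x y v w : E3) :
    inner ℝ (bisectorReflection x y v) (bisectorReflection x y w) = inner ℝ v w := by
  simp only [bisectorReflection_eq_reflection, LinearIsometryEquiv.inner_map_map]

lemma continuous_bisectorReflection (x y : E3) : Continuous (bisectorReflection x y) := by
  have : bisectorReflection x y = (Submodule.span ℝ {y - x})ᗮ.reflection :=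
    funext (bisectorReflection_eq_reflection x y)
  rw [this]
  exact LinearIsometryEquiv.continuous _

lemma bisectorReflection_neg (x y v : E3) :
    bisectorReflection x y (-v) = -bisectorReflection x y v := by
  simp only [bisectorReflection_eq_reflection, map_neg]

/-- A linear isometry of Euclidean 3-space of determinant `1` that fixes a plane pointwise is the
identity. -/
lemma eq_id_of_fixes_plane (T : E3 ≃ₗᵢ[ℝ] E3)
    (hdet : LinearMap.det (T.toLinearEquiv : E3 →ₗ[ℝ] E3) = 1) (F : Submodule ℝ E3)
    (hF : 2 ≤ Module.finrank ℝ F) (hfix : ∀ v ∈ F, T v = v) (v : E3) : T v = v := by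
  have hsum := Submodule.finrank_add_finrank_orthogonal F
  rw [finrank_euclideanSpace_fin] at hsum
  have hinv : ∀ w ∈ Fᗮ, T w ∈ Fᗮ := by
    intro w hw f hf
    rw [← hfix f hf, LinearIsometryEquiv.inner_map_map]
    exact hw f hf
  by_contra hv
  -- The complement is at most a line, invariant under `T`, so `T` acts on it by a sign; the sign
  -- `+1` would make `T` the identity.
  have key : ∀ w ∈ Fᗮ, T w = -w := by
    have hle : Module.finrank ℝ Fᗮ ≤ 1 := by omega
    rw [finrank_le_one_iff] at hle
    obtain ⟨⟨e, he⟩, hspan⟩ := hle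
    have hspan' : ∀ w ∈ Fᗮ, ∃ c : ℝ, c • e = w := by
      intro w hw
      obtain ⟨c, hc⟩ := hspan ⟨w, hw⟩
      exact ⟨c, by simpa using congrArg Subtype.val hc⟩
    obtain ⟨l, hl⟩ := hspan' (T e) (hinv e he)
    have hTe : T e = e ∨ T e = -e := by
      by_cases h0 : e = 0
      · left; simp [h0]
      have hn : ‖l • e‖ = ‖e‖ := by rw [hl, LinearIsometryEquiv.norm_map]
      rw [norm_smul] at hn
      have : |l| = 1 := by
        have := norm_pos_iff.mpr h0
        rw [← Real.norm_eq_abs]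
        field_simp at hn
        linarith
      rcases eq_or_eq_neg_of_abs_eq this with h | h
      · left; rw [← hl, h, one_smul]
      · right; rw [← hl, h, neg_one_smul]
    rcases hTe with h | h
    · exfalso
      apply hv
      have hdec : v ∈ F ⊔ Fᗮ := by rw [Submodule.sup_orthogonal_of_hasOrthogonalProjection]; trivial
      obtain ⟨f, hf, w, hw, rfl⟩ := Submodule.mem_sup.mp hdec
      obtain ⟨c, rfl⟩ := hspan' w hw
      rw [map_add, map_smul, h, hfix f hf]
    · intro w hw
      obtain ⟨c, rfl⟩ := hspan' w hw
      rw [map_smul, h, smul_neg]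
  have hT : T = F.reflection := by
    ext1 u
    have hdec : u ∈ F ⊔ Fᗮ := by rw [Submodule.sup_orthogonal_of_hasOrthogonalProjection]; trivial
    obtain ⟨f, hf, w, hw, rfl⟩ := Submodule.mem_sup.mp hdec
    rw [map_add, map_add, hfix f hf, key w hw, Submodule.reflection_mem_subspace_eq_self hf,
      Submodule.reflection_mem_subspace_orthogonalComplement_eq_neg hw]
  -- The determinant of the reflection in `F` excludes a one-dimensional complement, and then `F` is
  -- the whole space, on which `T` is the identity.
  have hd : (-1 : ℝ) ^ Module.finrank ℝ Fᗮ = 1 := by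
    rw [← Submodule.det_reflection (K := F), ← hdet, hT]
  rcases (show Module.finrank ℝ Fᗮ = 0 ∨ Module.finrank ℝ Fᗮ = 1 by omega) with h | h
  · rw [Submodule.finrank_eq_zero, Submodule.orthogonal_eq_bot_iff] at h
    exact hv (hfix v (h ▸ Submodule.mem_top))
  · rw [h] at hd
    norm_num at hd

lemma det_bisector (u : E3) (hu : u ≠ 0) :
    LinearMap.det ((Submodule.span ℝ {u})ᗮ.reflection.toLinearEquiv : E3 →ₗ[ℝ] E3) = -1 := by
  have := Submodule.det_reflection (K := (Submodule.span ℝ {u})ᗮ)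
  rw [Submodule.orthogonal_orthogonal, finrank_span_singleton hu, pow_one] at this
  exact this

/-- The radius vectors of two points of a circle have equal length, so the reflection along their
difference exchanges them. -/
lemma bisectorReflection_sub_center {c a b : E3} {r : ℝ} (ha : dist a c = r) (hb : dist b c = r) :
    bisectorReflection a b (a - c) = b - c := by
  have h : ‖b - c‖ = ‖a - c‖ := by rw [← dist_eq_norm, ← dist_eq_norm, ha, hb]
  have h2 := Submodule.reflection_sub h.symm
  rw [bisectorReflection_eq_reflection]
  have h3 : Submodule.span ℝ {(a - c) - (b - c)} = Submodule.span ℝ {b - a} := by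
    rw [show (a - c) - (b - c) = -(b - a) by abel, ← Set.neg_singleton, Submodule.span_neg]
  simp only [h3] at h2
  exact h2

lemma bisectorReflection_of_inner_eq_zero {x y v : E3} (h : inner ℝ (y - x) v = 0) :
    bisectorReflection x y v = v := by
  simp [bisectorReflection, h]

lemma bisectorReflection_line {x y e : E3} {t : ℝ} (hxy : x ≠ y) (h : y - x = t • e) (v : E3) :
    bisectorReflection x y v = (Submodule.span ℝ {e})ᗮ.reflection v := by
  have ht : t ≠ 0 := by
    rintro rfl
    rw [zero_smul, sub_eq_zero] at h
    exact hxy h.symm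
  rw [bisectorReflection_eq_reflection]
  have : Submodule.span ℝ {y - x} = Submodule.span ℝ {e} := by
    rw [h]; exact Submodule.span_singleton_smul_eq (IsUnit.mk0 t ht) e
  simp only [this]

/-- The reflections in the bisecting planes of the edges of a circular quadrilateral have trivial
holonomy. -/
lemma bisectorReflection_comm {a b c d : E3}
    (h : Concircular {(a : E3hat), (b : E3hat), (c : E3hat), (d : E3hat)})
    (hab : a ≠ b) (hbc : b ≠ c) (hdc : d ≠ c) (had : a ≠ d) (v : E3) :
    bisectorReflection b c (bisectorReflection a b v) =
      bisectorReflection d c (bisectorReflection a d v) := by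
  obtain ⟨K, hK | hK, hS⟩ := h
  · obtain ⟨A, o, r, hA, ho, hr, rfl⟩ := hK
    have hmem : ∀ p : E3, (p : E3hat) ∈ ({(a : E3hat), (b : E3hat), (c : E3hat), (d : E3hat)} :
        Set E3hat) → p ∈ A ∧ dist p o = r := by
      intro p hp
      obtain ⟨q, hq, hqp⟩ := hS hp
      rw [OnePoint.coe_eq_coe] at hqp
      exact hqp ▸ hq
    obtain ⟨ha, ha'⟩ := hmem a (by simp)
    obtain ⟨hb, hb'⟩ := hmem b (by simp)
    obtain ⟨hc, hc'⟩ := hmem c (by simp)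
    obtain ⟨hd, hd'⟩ := hmem d (by simp)
    -- The holonomy of the closed path `a`, `b`, `c`, `d`, `a`.
    let T : E3 ≃ₗᵢ[ℝ] E3 :=
      (((Submodule.span ℝ {b - a})ᗮ.reflection.trans (Submodule.span ℝ {c - b})ᗮ.reflection).trans
        (Submodule.span ℝ {c - d})ᗮ.reflection).trans (Submodule.span ℝ {d - a})ᗮ.reflection
    have hT : ∀ v, T v = bisectorReflection a d (bisectorReflection d c
        (bisectorReflection b c (bisectorReflection a b v))) := by
      intro v
      simp only [bisectorReflection_eq_reflection]
      rfl
    have hdet : LinearMap.det (T.toLinearEquiv : E3 →ₗ[ℝ] E3) = 1 := by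
      have : (T.toLinearEquiv : E3 →ₗ[ℝ] E3) =
          ((Submodule.span ℝ {d - a})ᗮ.reflection.toLinearEquiv : E3 →ₗ[ℝ] E3) ∘ₗ
          ((Submodule.span ℝ {c - d})ᗮ.reflection.toLinearEquiv : E3 →ₗ[ℝ] E3) ∘ₗ
          ((Submodule.span ℝ {c - b})ᗮ.reflection.toLinearEquiv : E3 →ₗ[ℝ] E3) ∘ₗ
          ((Submodule.span ℝ {b - a})ᗮ.reflection.toLinearEquiv : E3 →ₗ[ℝ] E3) := rfl
      rw [this, LinearMap.det_comp, LinearMap.det_comp, LinearMap.det_comp,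
        det_bisector _ (sub_ne_zero.mpr hab.symm), det_bisector _ (sub_ne_zero.mpr hbc.symm),
        det_bisector _ (sub_ne_zero.mpr hdc.symm), det_bisector _ (sub_ne_zero.mpr had.symm)]
      norm_num
    have hao : a - o ∈ A.direction := AffineSubspace.vsub_mem_direction ha ho
    have hao0 : a - o ≠ 0 := by
      rw [Ne, ← norm_eq_zero, ← dist_eq_norm, ha']
      exact hr.ne'
    -- The fixed plane is spanned by the normal of the plane of the circle and the radius vector at
    -- `a`. The normal is orthogonal to every edge; the radius vector is carried around the circle
    -- from vertex to vertex.
    have hrank : 2 ≤ Module.finrank ℝ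
        (A.directionᗮ ⊔ Submodule.span ℝ {a - o} : Submodule ℝ E3) := by
      have h1 := Submodule.finrank_sup_add_finrank_inf_eq A.directionᗮ (Submodule.span ℝ {a - o})
      have h2 : A.directionᗮ ⊓ Submodule.span ℝ {a - o} = ⊥ := by
        rw [eq_bot_iff, ← Submodule.inf_orthogonal_eq_bot A.direction]
        refine le_inf ?_ inf_le_left
        exact inf_le_right.trans ((Submodule.span_singleton_le_iff_mem _ _).mpr hao)
      have h3 := Submodule.finrank_add_finrank_orthogonal A.direction
      rw [finrank_euclideanSpace_fin] at h3
      rw [h2, finrank_bot, finrank_span_singleton hao0] at h1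
      omega
    have hfix : ∀ w ∈ (A.directionᗮ ⊔ Submodule.span ℝ {a - o} : Submodule ℝ E3), T w = w := by
      intro w hw
      obtain ⟨n, hn, m, hm, rfl⟩ := Submodule.mem_sup.mp hw
      obtain ⟨k, rfl⟩ := Submodule.mem_span_singleton.mp hm
      have e1 : T n = n := by
        have aux : ∀ x y : E3, x ∈ A → y ∈ A → bisectorReflection x y n = n := fun x y hx hy =>
          bisectorReflection_of_inner_eq_zero (hn _ (AffineSubspace.vsub_mem_direction hy hx))
        rw [hT, aux a b ha hb, aux b c hb hc, aux d c hd hc, aux a d ha hd]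
      have e2 : T (a - o) = a - o := by
        rw [hT, bisectorReflection_sub_center ha' hb', bisectorReflection_sub_center hb' hc',
          ← bisectorReflection_sub_center hd' hc', bisectorReflection_involutive,
          ← bisectorReflection_sub_center ha' hd', bisectorReflection_involutive]
      rw [map_add, map_smul, e1, e2]
    have := eq_id_of_fixes_plane T hdet _ hrank hfix v
    rw [hT] at this
    have h2 := congrArg (fun w => bisectorReflection d c (bisectorReflection a d w)) this
    simp only [bisectorReflection_involutive _ _ _] at h2
    exact h2
  · obtain ⟨A, hA, rfl⟩ := hK
    have hmem : ∀ p : E3, (p : E3hat) ∈ ({(a : E3hat), (b : E3hat), (c : E3hat), (d : E3hat)} :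
        Set E3hat) → p ∈ A := by
      intro p hp
      rcases hS hp with h | ⟨q, hq, hqp⟩
      · exact absurd h (OnePoint.coe_ne_infty p)
      · rw [OnePoint.coe_eq_coe] at hqp
        exact hqp ▸ hq
    have ha := hmem a (by simp)
    have hb := hmem b (by simp)
    have hc := hmem c (by simp)
    have hd := hmem d (by simp)
    obtain ⟨⟨e, he⟩, -, hspan⟩ := finrank_eq_one_iff'.mp hA
    -- On a line every edge has the direction `e`, so all four reflections agree.
    have key : ∀ x y : E3, x ∈ A → y ∈ A → x ≠ y → ∀ v,
        bisectorReflection x y v = (Submodule.span ℝ {e})ᗮ.reflection v := by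
      intro x y hx hy hxy v
      obtain ⟨t, ht⟩ := hspan ⟨y - x, AffineSubspace.vsub_mem_direction hy hx⟩
      exact bisectorReflection_line hxy (congrArg Subtype.val ht).symm v
    rw [key a b ha hb hab, key b c hb hc hbc, key d c hd hc hdc, key a d ha hd had]

/-! ## Transport of frames along the edges of a cube -/

/-- The passage from the frame at `X S` to the frame at `X (insert i S)`. -/
def edgeMap (X : CubeVertex → E3) (S : CubeVertex) (i : Fin 3) (t : Fin 3 → E3) : Fin 3 → E3 :=
  fun k => bisectorReflection (X S) (X (insert i S)) (if k = i then -t k else t k)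

lemma edgeMap_involutive (X : CubeVertex → E3) (S : CubeVertex) (i : Fin 3) :
    Function.Involutive (edgeMap X S i) := by
  intro t
  funext k
  by_cases h : k = i
  · simp [edgeMap, h, bisectorReflection_neg, bisectorReflection_involutive _ _ _]
  · simp [edgeMap, h, bisectorReflection_involutive _ _ _]

lemma continuous_edgeMap (X : CubeVertex → E3) (S : CubeVertex) (i : Fin 3) :
    Continuous (edgeMap X S i) := by
  refine continuous_pi fun k => (continuous_bisectorReflection _ _).comp ?_
  split_ifs
  · exact (continuous_apply k).neg
  · exact continuous_apply k

lemma orthonormal_edgeMap {X : CubeVertex → E3} {t : Fin 3 → E3} (ht : Orthonormal ℝ t)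
    (S : CubeVertex) (i : Fin 3) : Orthonormal ℝ (edgeMap X S i t) := by
  rw [orthonormal_iff_ite] at ht ⊢
  intro j k
  rw [edgeMap, edgeMap, inner_bisectorReflection, ← ht j k]
  by_cases hj : j = i <;> by_cases hk : k = i
  · simp [hj, hk]
  · have : j ≠ k := fun h => hk (h ▸ hj)
    simp [hj, hk, ht, Ne.symm hk]
  · have : j ≠ k := fun h => hj (h ▸ hk)
    simp [hj, hk, ht]
  · simp [hj, hk]

/-- The edge map as a homeomorphism. -/
def edgeHomeo (X : CubeVertex → E3) (S : CubeVertex) (i : Fin 3) :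
    (Fin 3 → E3) ≃ₜ (Fin 3 → E3) where
  toEquiv := (edgeMap_involutive X S i).toPerm
  continuous_toFun := continuous_edgeMap X S i
  continuous_invFun := continuous_edgeMap X S i

lemma nodup_four {α : Type*} {a b c d : α} (h : [a, b, c, d].Nodup) :
    a ≠ b ∧ a ≠ c ∧ a ≠ d ∧ b ≠ c ∧ b ≠ d ∧ c ≠ d := by
  simp at h
  tauto

/-- The sign changes in directions `i` and `j` pull out of the reflections, which leaves the trivial
holonomy of the circular face. Embeddedness is needed only to know that its vertices are distinct.
-/
lemma edgeMap_comm {X : CubeVertex → E3} (hX : IsSphericalCube X) (hE : HasEmbeddedFaces X)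
    {S : CubeVertex} {i j : Fin 3} (hi : i ∉ S) (hj : j ∉ S) (hij : i ≠ j) (t : Fin 3 → E3) :
    edgeMap X (insert i S) j (edgeMap X S i t) = edgeMap X (insert j S) i (edgeMap X S j t) := by
  funext k
  have hc := hX S i j hi hj hij
  obtain ⟨h1, h2, h3, h4, h5, h6⟩ := nodup_four (hE S i j hi hj hij).1
  have key := bisectorReflection_comm hc h1 h4 h6.symm h3
  simp only [edgeMap]
  rw [Finset.insert_comm j i S]
  by_cases hki : k = i
  · subst hki
    simp only [if_true, if_neg hij, key, bisectorReflection_neg]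
  · by_cases hkj : k = j
    · subst hkj
      simp only [if_true, if_neg hki, ← key, bisectorReflection_neg]
    · simp only [if_neg hki, if_neg hkj, key]

/-- Maps along the edges of the 3-cube that commute around its faces integrate to maps from the
vertex `∅` to all vertices. -/
lemma exists_transport {M : Type*} [TopologicalSpace M] (E : CubeVertex → Fin 3 → M ≃ₜ M)
    (hE : ∀ S i j, i ∉ S → j ∉ S → i ≠ j → ∀ t,
      E (insert i S) j (E S i t) = E (insert j S) i (E S j t)) :
    ∃ F : CubeVertex → M ≃ₜ M, (∀ t, F ∅ t = t) ∧
      ∀ S i, i ∉ S → ∀ t, F (insert i S) t = E S i (F S t) := by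
  -- Each vertex is reached from `∅` by inserting directions in the order 0, 1, 2. An edge outside
  -- this tree of paths is handled by the face relations.
  let G1 : CubeVertex → M ≃ₜ M := fun S => if 0 ∈ S then E ∅ 0 else Homeomorph.refl M
  let G2 : CubeVertex → M ≃ₜ M := fun S =>
    (G1 S).trans (if 1 ∈ S then (if 0 ∈ S then E {0} 1 else E ∅ 1) else Homeomorph.refl M)
  let G3 : CubeVertex → M ≃ₜ M := fun S =>
    (G2 S).trans (if 2 ∈ S then
      (if 0 ∈ S then (if 1 ∈ S then E {0, 1} 2 else E {0} 2)
        else (if 1 ∈ S then E {1} 2 else E ∅ 2)) else Homeomorph.refl M)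
  have h01 : ∀ t, E {0} 1 (E ∅ 0 t) = E {1} 0 (E ∅ 1 t) :=
    hE ∅ 0 1 (by decide) (by decide) (by decide)
  have h02 : ∀ t, E {0} 2 (E ∅ 0 t) = E {2} 0 (E ∅ 2 t) :=
    hE ∅ 0 2 (by decide) (by decide) (by decide)
  have h12 : ∀ t, E {1} 2 (E ∅ 1 t) = E {2} 1 (E ∅ 2 t) :=
    hE ∅ 1 2 (by decide) (by decide) (by decide)
  have h0 : ∀ t, E {0, 1} 2 (E {0} 1 t) = E {0, 2} 1 (E {0} 2 t) := by
    intro t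
    simpa only [show insert (1 : Fin 3) {0} = ({0, 1} : CubeVertex) by decide,
      show insert (2 : Fin 3) {0} = ({0, 2} : CubeVertex) by decide] using
      hE {0} 1 2 (by decide) (by decide) (by decide) t
  have h1 : ∀ t, E {0, 1} 2 (E {1} 0 t) = E {1, 2} 0 (E {1} 2 t) := by
    intro t
    simpa only [show insert (0 : Fin 3) {1} = ({0, 1} : CubeVertex) by decide,
      show insert (2 : Fin 3) {1} = ({1, 2} : CubeVertex) by decide] using
      hE {1} 0 2 (by decide) (by decide) (by decide) t
  have g0 : ∀ t, G3 ∅ t = t := fun t => by simp [G3, G2, G1]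
  have gs0 : ∀ t, G3 {0} t = E ∅ 0 t := fun t => by simp [G3, G2, G1]
  have gs1 : ∀ t, G3 {1} t = E ∅ 1 t := fun t => by simp [G3, G2, G1]
  have gs2 : ∀ t, G3 {2} t = E ∅ 2 t := fun t => by simp [G3, G2, G1]
  have g01 : ∀ t, G3 {0, 1} t = E {0} 1 (E ∅ 0 t) := fun t => by simp [G3, G2, G1]
  have g02 : ∀ t, G3 {0, 2} t = E {0} 2 (E ∅ 0 t) := fun t => by simp [G3, G2, G1]
  have g12 : ∀ t, G3 {1, 2} t = E {1} 2 (E ∅ 1 t) := fun t => by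
    simp [G3, G2, G1]
  have g012 : ∀ t, G3 {0, 1, 2} t = E {0, 1} 2 (E {0} 1 (E ∅ 0 t)) := fun t => by
    simp [G3, G2, G1]
  refine ⟨G3, g0, ?_⟩
  have hS : ∀ S : CubeVertex, S = ∅ ∨ S = {0} ∨ S = {1} ∨ S = {2} ∨ S = {0, 1} ∨ S = {0, 2} ∨
      S = {1, 2} ∨ S = {0, 1, 2} := by decide
  intro S i hi t
  rcases hS S with rfl | rfl | rfl | rfl | rfl | rfl | rfl | rfl <;> fin_cases i <;>
    first
    | exact absurd hi (by decide)
    | skip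
  · exact (gs0 t).trans (by rw [g0]; rfl)
  · exact (gs1 t).trans (by rw [g0]; rfl)
  · exact (gs2 t).trans (by rw [g0]; rfl)
  · exact (g01 t).trans (by rw [gs0]; rfl)
  · exact (g02 t).trans (by rw [gs0]; rfl)
  · exact (g01 t).trans (by rw [gs1, h01]; rfl)
  · exact (g12 t).trans (by rw [gs1]; rfl)
  · exact (g02 t).trans (by rw [gs2, h02]; rfl)
  · exact (g12 t).trans (by rw [gs2, h12]; rfl)
  · exact (g012 t).trans (by rw [g01]; rfl)
  -- The last two edges into the full vertex leave the chosen path: one face has to be crossed when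
  -- coming from `{0, 2}`, two faces when coming from `{1, 2}`.
  · exact (g012 t).trans ((h0 _).trans (congrArg (E {0, 2} 1) (g02 t).symm))
  · exact (g012 t).trans ((congrArg _ (h01 t)).trans
      ((h1 _).trans (congrArg (E {1, 2} 0) (g12 t).symm)))

lemma isCyclidicCube_evolution_iff (X : CubeVertex → E3) (B : CubeVertex → Fin 3 → E3) :
    (∀ (S : CubeVertex) (i : Fin 3), i ∉ S → ∀ k : Fin 3, B (insert i S) k =
      bisectorReflection (X S) (X (insert i S)) (if k = i then -B S k else B S k)) ↔
    ∀ (S : CubeVertex) (i : Fin 3), i ∉ S → B (insert i S) = edgeMap X S i (B S) := by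
  simp only [funext_iff, edgeMap]

/-- Evaluation of cyclidic cubes at a vertex is a homeomorphism onto the orthonormal frames. -/
theorem exists_homeomorph_frames {X : CubeVertex → E3} (hX : IsSphericalCube X)
    (hE : HasEmbeddedFaces X) (S : CubeVertex) :
    ∃ e : CyclidicCubesOn X ≃ₜ OrthonormalFrames,
      ∀ B : CyclidicCubesOn X, (e B : Fin 3 → E3) = (B : CubeVertex → Fin 3 → E3) S := by
  obtain ⟨F, hF0, hF⟩ := exists_transport (edgeHomeo X)
    (fun S i j hi hj hij t => edgeMap_comm hX hE hi hj hij t)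
  replace hF : ∀ S i, i ∉ S → ∀ t, F (insert i S) t = edgeMap X S i (F S t) := hF
  have horth : ∀ S t, Orthonormal ℝ (F S t) ↔ Orthonormal ℝ t := by
    intro S t
    induction S using Finset.induction_on with
    | empty => rw [hF0]
    | insert i S hi ih =>
      rw [← ih, hF S i hi]
      refine ⟨fun h => ?_, fun h => orthonormal_edgeMap h S i⟩
      have := orthonormal_edgeMap (X := X) h S i
      rwa [edgeMap_involutive] at this
  have hdet : ∀ B ∈ CyclidicCubesOn X, ∀ S, B S = F S (B ∅) := by
    intro B hB S
    have hev := (isCyclidicCube_evolution_iff X B).mp hB.evolution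
    induction S using Finset.induction_on with
    | empty => rw [hF0]
    | insert i S hi ih => rw [hev S i hi, hF S i hi, ← ih]
  have hmem : ∀ t, Orthonormal ℝ t → (fun S' => F S' t) ∈ CyclidicCubesOn X := fun t ht =>
    ⟨hX, hE, fun S' => (horth S' t).mpr ht,
      (isCyclidicCube_evolution_iff X fun S' => F S' t).mpr fun S' i hi => hF S' i hi t⟩
  have hsymm : ∀ t, Orthonormal ℝ t → Orthonormal ℝ ((F S).symm t) := fun t ht => by
    rwa [← horth S, Homeomorph.apply_symm_apply]
  refine ⟨{
    toFun := fun B => ⟨B.1 S, B.2.orthonormal S⟩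
    invFun := fun t => ⟨fun S' => F S' ((F S).symm t.1), hmem _ (hsymm _ t.2)⟩
    left_inv := ?_
    right_inv := ?_
    continuous_toFun := ?_
    continuous_invFun := ?_ }, fun B => rfl⟩
  · rintro ⟨B, hB⟩
    ext1
    funext S'
    simp only
    rw [hdet B hB S, Homeomorph.symm_apply_apply, ← hdet B hB S']
  · rintro ⟨t, ht⟩
    ext1
    exact (F S).apply_symm_apply t
  · exact ((continuous_apply S).comp continuous_subtype_val).subtype_mk _
  · refine Continuous.subtype_mk (continuous_pi fun S' => ?_) _
    exact (F S').continuous.comp ((F S).symm.continuous.comp continuous_subtype_val)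

/-! ## Cayley charts for the orthonormal frames -/

/-- The Cayley transform. -/
def cayley (Q : Matrix (Fin 3) (Fin 3) ℝ) : Matrix (Fin 3) (Fin 3) ℝ := (1 - Q) * (1 + Q)⁻¹

/-- Together with `one_sub_cayley` this makes the Cayley transform an involution where it is
defined: in the quotient of `1 - cayley Q` by `1 + cayley Q` the factor `2 (1 + Q)⁻¹` cancels and
leaves `Q`. -/
lemma one_add_cayley {Q : Matrix (Fin 3) (Fin 3) ℝ} (h : IsUnit (1 + Q).det) :
    1 + cayley Q = (2 : ℝ) • (1 + Q)⁻¹ := by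
  have : (1 + cayley Q) * (1 + Q) = ((2 : ℝ) • (1 + Q)⁻¹) * (1 + Q) := by
    rw [add_mul, cayley, mul_assoc, Matrix.smul_mul, Matrix.nonsing_inv_mul _ h, two_smul]
    noncomm_ring
  have h2 := congrArg (· * (1 + Q)⁻¹) this
  simpa only [mul_assoc, Matrix.mul_nonsing_inv _ h, mul_one] using h2

lemma one_sub_cayley {Q : Matrix (Fin 3) (Fin 3) ℝ} (h : IsUnit (1 + Q).det) :
    1 - cayley Q = Q * ((2 : ℝ) • (1 + Q)⁻¹) := by
  have : (1 - cayley Q) * (1 + Q) = (Q * ((2 : ℝ) • (1 + Q)⁻¹)) * (1 + Q) := by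
    rw [sub_mul, cayley, mul_assoc, mul_assoc, Matrix.smul_mul, Matrix.nonsing_inv_mul _ h,
      two_smul]
    noncomm_ring
  have h2 := congrArg (· * (1 + Q)⁻¹) this
  simpa only [mul_assoc, Matrix.mul_nonsing_inv _ h, mul_one] using h2

lemma isUnit_det_one_add_cayley {Q : Matrix (Fin 3) (Fin 3) ℝ} (h : IsUnit (1 + Q).det) :
    IsUnit (1 + cayley Q).det := by
  rw [one_add_cayley h, Matrix.det_smul]
  exact IsUnit.mul (by norm_num) (by rw [Matrix.isUnit_nonsing_inv_det_iff]; exact h)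

lemma cayley_cayley {Q : Matrix (Fin 3) (Fin 3) ℝ} (h : IsUnit (1 + Q).det) :
    cayley (cayley Q) = Q := by
  have h2 := isUnit_det_one_add_cayley h
  rw [one_add_cayley h] at h2
  rw [cayley, one_sub_cayley h, one_add_cayley h, mul_assoc, Matrix.mul_nonsing_inv _ h2, mul_one]

lemma cayley_eq_inv_mul {Q : Matrix (Fin 3) (Fin 3) ℝ} (h : IsUnit (1 + Q).det) :
    cayley Q = (1 + Q)⁻¹ * (1 - Q) := by
  have : (1 + Q) * cayley Q = (1 - Q) := by
    rw [cayley, ← mul_assoc, show (1 + Q) * (1 - Q) = (1 - Q) * (1 + Q) by noncomm_ring, mul_assoc,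
      Matrix.mul_nonsing_inv _ h, mul_one]
  rw [← this, ← mul_assoc, Matrix.nonsing_inv_mul _ h, one_mul]

open Matrix in
lemma transpose_cayley {Q : Matrix (Fin 3) (Fin 3) ℝ} (h : IsUnit (1 + Q).det) :
    (cayley Q)ᵀ = cayley Qᵀ := by
  have h' : IsUnit (1 + Qᵀ).det := by
    rwa [← Matrix.det_transpose, Matrix.transpose_add, Matrix.transpose_one,
      Matrix.transpose_transpose]
  rw [cayley_eq_inv_mul h', cayley, Matrix.transpose_mul, Matrix.transpose_nonsing_inv]
  simp

open Matrix in
-- Transposition turns `Q` into its inverse, and replacing `Q` by its inverse in `(1 - Q) / (1 + Q)`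
-- changes the sign.
lemma cayley_skew {Q : Matrix (Fin 3) (Fin 3) ℝ} (h : IsUnit (1 + Q).det) (hQ : Qᵀ * Q = 1) :
    (cayley Q)ᵀ = -cayley Q := by
  have hQ' : Q * Qᵀ = 1 := mul_eq_one_comm.mp hQ
  have h' : IsUnit (1 + Qᵀ).det := by
    rwa [← Matrix.det_transpose, Matrix.transpose_add, Matrix.transpose_one,
      Matrix.transpose_transpose]
  rw [transpose_cayley h, cayley_eq_inv_mul h']
  have key : (1 - Qᵀ) * (1 + Q) = -((1 + Qᵀ) * (1 - Q)) := by
    simp only [sub_mul, add_mul, mul_add, mul_sub, hQ, one_mul, mul_one]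
    abel
  calc (1 + Qᵀ)⁻¹ * (1 - Qᵀ) = (1 + Qᵀ)⁻¹ * ((1 - Qᵀ) * (1 + Q)) * (1 + Q)⁻¹ := by
        rw [mul_assoc, mul_assoc, Matrix.mul_nonsing_inv _ h, mul_one]
    _ = -cayley Q := by
        rw [key, mul_neg, ← mul_assoc, Matrix.nonsing_inv_mul _ h', one_mul, neg_mul, cayley]

open Matrix in
lemma cayley_orthogonal {K : Matrix (Fin 3) (Fin 3) ℝ} (h : IsUnit (1 + K).det) (hK : Kᵀ = -K) :
    (cayley K)ᵀ * cayley K = 1 := by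
  have h' : IsUnit (1 - K).det := by
    rwa [← Matrix.det_transpose, Matrix.transpose_sub, Matrix.transpose_one, hK, sub_neg_eq_add]
  rw [transpose_cayley h, hK, cayley, cayley_eq_inv_mul h, sub_neg_eq_add, ← sub_eq_add_neg]
  have e : (1 - K)⁻¹ * (1 + K)⁻¹ = (1 + K)⁻¹ * (1 - K)⁻¹ := by
    rw [← Matrix.mul_inv_rev, ← Matrix.mul_inv_rev]
    congr 1
    noncomm_ring
  calc (1 + K) * (1 - K)⁻¹ * ((1 + K)⁻¹ * (1 - K)) = (1 + K) * ((1 - K)⁻¹ * (1 + K)⁻¹) * (1 - K) := by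
        simp only [mul_assoc]
    _ = ((1 + K) * (1 + K)⁻¹) * ((1 - K)⁻¹ * (1 - K)) := by rw [e]; simp only [mul_assoc]
    _ = 1 := by rw [Matrix.mul_nonsing_inv _ h, Matrix.nonsing_inv_mul _ h', one_mul]

/-- The skew-symmetric matrix with given entries. -/
def skew (v : EuclideanSpace ℝ (Fin 3)) : Matrix (Fin 3) (Fin 3) ℝ :=
  !![0, v 0, v 1; -v 0, 0, v 2; -v 1, -v 2, 0]

open Matrix in
lemma transpose_skew (v : EuclideanSpace ℝ (Fin 3)) : (skew v)ᵀ = -skew v := by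
  ext i j
  fin_cases i <;> fin_cases j <;> simp [skew]

/-- The determinant is `1 + ‖v‖²`. Hence the inverse chart is defined on all of `ℝ³`. -/
lemma isUnit_det_one_add_skew (v : EuclideanSpace ℝ (Fin 3)) : IsUnit (1 + skew v).det := by
  have : (1 + skew v).det = 1 + v 0 ^ 2 + v 1 ^ 2 + v 2 ^ 2 := by
    rw [Matrix.det_fin_three]
    simp [skew]
    ring
  rw [this, isUnit_iff_ne_zero]
  positivity

open Matrix in
lemma skew_entries {K : Matrix (Fin 3) (Fin 3) ℝ} (hK : Kᵀ = -K) :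
    skew (WithLp.toLp 2 ![K 0 1, K 0 2, K 1 2]) = K := by
  have h : ∀ i j, K j i = -K i j := fun i j => congrFun (congrFun hK i) j
  have hd : ∀ i, K i i = 0 := fun i => by linarith [h i i]
  ext i j
  fin_cases i <;> fin_cases j <;> simp [skew, hd, h 0 1, h 0 2, h 1 2]

/-- The matrix of the frame `t` with respect to the frame `b`. -/
def frameMatrix (b t : Fin 3 → E3) : Matrix (Fin 3) (Fin 3) ℝ := fun i j => inner ℝ (b i) (t j)

/-- The frame with matrix `Q` with respect to the frame `b`. -/
def frameOf (b : Fin 3 → E3) (Q : Matrix (Fin 3) (Fin 3) ℝ) : Fin 3 → E3 :=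
  fun j => ∑ i, Q i j • b i

lemma frameMatrix_frameOf {b : Fin 3 → E3} (hb : Orthonormal ℝ b)
    (Q : Matrix (Fin 3) (Fin 3) ℝ) : frameMatrix b (frameOf b Q) = Q := by
  ext i j
  simp only [frameMatrix, frameOf]
  exact hb.inner_right_fintype _ i

lemma frameOf_frameMatrix {b : Fin 3 → E3} (hb : Orthonormal ℝ b) (t : Fin 3 → E3) :
    frameOf b (frameMatrix b t) = t := by
  have hspan : ⊤ ≤ Submodule.span ℝ (Set.range b) := by
    rw [LinearIndependent.span_eq_top_of_card_eq_finrank hb.linearIndependent (by simp)]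
  funext j
  have := (OrthonormalBasis.mk hb hspan).sum_repr' (t j)
  simpa [frameOf, frameMatrix] using this

open Matrix in
lemma orthonormal_frameOf_iff {b : Fin 3 → E3} (hb : Orthonormal ℝ b)
    (Q : Matrix (Fin 3) (Fin 3) ℝ) : Orthonormal ℝ (frameOf b Q) ↔ Qᵀ * Q = 1 := by
  rw [orthonormal_iff_ite, ← Matrix.ext_iff]
  refine forall_congr' fun i => forall_congr' fun j => ?_
  have : inner ℝ (frameOf b Q i) (frameOf b Q j) = (Qᵀ * Q) i j := by
    rw [frameOf, frameOf, hb.inner_sum]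
    simp [Matrix.mul_apply]
  rw [this, Matrix.one_apply]

lemma continuousOn_cayley : ContinuousOn cayley {Q | IsUnit (1 + Q).det} := by
  intro Q hQ
  refine ContinuousAt.continuousWithinAt ?_
  unfold cayley
  have h1 : ContinuousAt (fun Q : Matrix (Fin 3) (Fin 3) ℝ => (1 + Q)) Q := by fun_prop
  have h2 : ContinuousAt (fun Q : Matrix (Fin 3) (Fin 3) ℝ => (1 + Q)⁻¹) Q := by
    refine ContinuousAt.comp (g := fun A : Matrix (Fin 3) (Fin 3) ℝ => A⁻¹) ?_ h1
    refine continuousAt_matrix_inv _ ?_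
    simpa [Ring.inverse_eq_inv'] using continuousAt_inv₀ (isUnit_iff_ne_zero.mp hQ)
  have h3 : ContinuousAt (fun Q : Matrix (Fin 3) (Fin 3) ℝ => (1 - Q)) Q := by fun_prop
  exact h3.mul h2

/-- Every orthonormal frame has a neighbourhood homeomorphic to an open subset of `ℝ³`. -/
theorem exists_chart_frames (b : OrthonormalFrames) :
    ∃ φ : OpenPartialHomeomorph OrthonormalFrames (EuclideanSpace ℝ (Fin 3)), b ∈ φ.source := by
  obtain ⟨b, hb⟩ := b
  replace hb : Orthonormal ℝ b := hb
  have hcont : Continuous fun t : OrthonormalFrames => frameMatrix b t.1 := by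
    refine continuous_matrix fun i j => ?_
    exact Continuous.inner continuous_const ((continuous_apply j).comp continuous_subtype_val)
  have hcont2 : Continuous (frameOf b) := by
    refine continuous_pi fun j => continuous_finsetSum _ fun i _ => ?_
    exact (continuous_id.matrix_elem i j).smul continuous_const
  have hcskew : Continuous skew := by
    refine continuous_matrix fun i j => ?_
    fin_cases i <;> fin_cases j <;> simp [skew] <;> fun_prop
  have horth : ∀ t : OrthonormalFrames,
      (frameMatrix b t.1).transpose * frameMatrix b t.1 = 1 := fun t => by
    rw [← orthonormal_frameOf_iff hb, frameOf_frameMatrix hb]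
    exact t.2
  refine ⟨{
    toFun := fun t => WithLp.toLp 2 ![cayley (frameMatrix b t.1) 0 1,
      cayley (frameMatrix b t.1) 0 2, cayley (frameMatrix b t.1) 1 2]
    invFun := fun v => ⟨frameOf b (cayley (skew v)), (orthonormal_frameOf_iff hb _).mpr
      (cayley_orthogonal (isUnit_det_one_add_skew v) (transpose_skew v))⟩
    source := {t | IsUnit (1 + frameMatrix b t.1).det}
    target := Set.univ
    map_source' := fun _ _ => Set.mem_univ _
    map_target' := ?_
    left_inv' := ?_
    right_inv' := ?_
    open_source := ?_
    open_target := isOpen_univ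
    continuousOn_toFun := ?_
    continuousOn_invFun := ?_ }, ?_⟩
  · intro v _
    simp only [Set.mem_ofPred_eq, frameMatrix_frameOf hb]
    exact isUnit_det_one_add_cayley (isUnit_det_one_add_skew v)
  · intro t ht
    ext1
    simp only
    rw [skew_entries (cayley_skew ht (horth t)), cayley_cayley ht, frameOf_frameMatrix hb]
  · intro v _
    simp only [frameMatrix_frameOf hb, cayley_cayley (isUnit_det_one_add_skew v)]
    ext i
    fin_cases i <;> simp [skew]
  · have h1 : ContinuousOn (fun t : OrthonormalFrames => cayley (frameMatrix b t.1))
        {t | IsUnit (1 + frameMatrix b t.1).det} :=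
      continuousOn_cayley.comp hcont.continuousOn fun t ht => ht
    have h2 : Continuous fun K : Matrix (Fin 3) (Fin 3) ℝ =>
        (WithLp.toLp 2 ![K 0 1, K 0 2, K 1 2] : EuclideanSpace ℝ (Fin 3)) := by
      refine (PiLp.continuous_toLp 2 _).comp (continuous_pi fun i => ?_)
      fin_cases i <;> exact continuous_id.matrix_elem _ _
    exact h2.comp_continuousOn h1
  · refine Continuous.continuousOn (Continuous.subtype_mk (hcont2.comp ?_) _)
    exact continuousOn_cayley.comp_continuous hcskew isUnit_det_one_add_skew
  · simp only [isUnit_iff_ne_zero]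
    refine isOpen_ne_fun ?_ continuous_const
    exact (continuous_const.add hcont).matrix_det
  -- The chart is centred at `b`, where the relative matrix is 1 and `1 + 1` is invertible.
  · have : frameMatrix b b = 1 := by
      ext i j
      rw [frameMatrix, Matrix.one_apply]
      exact (orthonormal_iff_ite.mp hb) i j
    simp only [Set.mem_ofPred_eq, this]
    rw [one_add_one_eq_two, Matrix.det_fin_three]
    rw [isUnit_iff_ne_zero]
    simp [Matrix.ofNat_apply]

/-! ## The Lie form and point spheres -/

lemma lieForm_comm (u w : LieVec) : lieForm u w = lieForm w u := by
  simp only [lieForm, real_inner_comm w.1 u.1]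
  ring

lemma lieForm_add_left (u u' w : LieVec) : lieForm (u + u') w = lieForm u w + lieForm u' w := by
  simp only [lieForm, Prod.fst_add, Prod.snd_add, inner_add_left]
  ring

lemma lieForm_smul_left (c : ℝ) (u w : LieVec) : lieForm (c • u) w = c * lieForm u w := by
  simp only [lieForm, Prod.smul_fst, Prod.smul_snd, real_inner_smul_left, smul_eq_mul]
  ring

/-- The Lie form as a bilinear form. -/
def lieBilin : LinearMap.BilinForm ℝ LieVec :=
  LinearMap.mk₂ ℝ lieForm lieForm_add_left lieForm_smul_left
    (fun u w w' => by
      rw [lieForm_comm, lieForm_add_left, lieForm_comm w, lieForm_comm w'])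
    (fun c u w => by rw [lieForm_comm, lieForm_smul_left, lieForm_comm, smul_eq_mul])

lemma lieForm_add_right (u w w' : LieVec) : lieForm u (w + w') = lieForm u w + lieForm u w' :=
  map_add (lieBilin u) w w'

lemma lieForm_smul_right (c : ℝ) (u w : LieVec) : lieForm u (c • w) = c * lieForm u w :=
  map_smul (lieBilin u) c w

lemma lieForm_neg_left (u w : LieVec) : lieForm (-u) w = -lieForm u w :=
  lieBilin.map_neg₂ u w

lemma lieForm_neg_right (u w : LieVec) : lieForm u (-w) = -lieForm u w :=
  map_neg (lieBilin u) w

lemma lieForm_sub_left (u u' w : LieVec) : lieForm (u - u') w = lieForm u w - lieForm u' w :=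
  lieBilin.map_sub₂ u u' w

lemma lieForm_sub_right (u w w' : LieVec) : lieForm u (w - w') = lieForm u w - lieForm u w' :=
  map_sub (lieBilin u) w w'

lemma lieForm_zero_left (w : LieVec) : lieForm 0 w = 0 := lieBilin.map_zero₂ w

lemma pointRep_coe (x : E3) : pointRep (x : E3hat) = (x, 1, ‖x‖ ^ 2, 0) := rfl

lemma pointRep_infty : pointRep OnePoint.infty = (0, 0, 1, 0) := rfl

lemma pointRep_ne_zero (p : E3hat) : pointRep p ≠ 0 := by
  induction p using OnePoint.rec with
  | infty => simp [pointRep_infty]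
  | coe x => simp [pointRep_coe]

lemma pointRep_r (p : E3hat) : (pointRep p).2.2.2 = 0 := by
  induction p using OnePoint.rec with
  | infty => rfl
  | coe x => rfl

lemma lieForm_pointRep_coe (x y : E3) :
    lieForm (pointRep (x : E3hat)) (pointRep (y : E3hat)) = -‖x - y‖ ^ 2 / 2 := by
  simp only [lieForm, pointRep_coe, norm_sub_sq_real]
  ring

lemma lieForm_pointRep_self (p : E3hat) : lieForm (pointRep p) (pointRep p) = 0 := by
  induction p using OnePoint.rec with
  | infty => simp [lieForm, pointRep_infty]
  | coe x => simp [lieForm_pointRep_coe]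

/-- On finite points the form is minus half the squared distance; between `∞` and a finite point it
is a nonzero constant. Contact of point spheres is therefore equality. -/
lemma lieForm_pointRep_eq_zero_iff (p q : E3hat) :
    lieForm (pointRep p) (pointRep q) = 0 ↔ p = q := by
  refine ⟨fun h => ?_, fun h => h ▸ lieForm_pointRep_self p⟩
  induction p using OnePoint.rec with
  | infty =>
    induction q using OnePoint.rec with
    | infty => rfl
    | coe y => simp [lieForm, pointRep_infty, pointRep_coe] at h
  | coe x =>
    induction q using OnePoint.rec with
    | infty => simp [lieForm, pointRep_infty, pointRep_coe] at h
    | coe y =>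
      rw [lieForm_pointRep_coe] at h
      have : ‖x - y‖ = 0 := by
        have : ‖x - y‖ ^ 2 = 0 := by linarith
        exact pow_eq_zero_iff two_ne_zero |>.mp this
      rw [norm_eq_zero, sub_eq_zero] at this
      rw [this]

lemma eq_of_pointRep_eq_smul {p q : E3hat} {c : ℝ} (h : pointRep p = c • pointRep q) : p = q := by
  rw [← lieForm_pointRep_eq_zero_iff, h, lieForm_smul_left, lieForm_pointRep_self, mul_zero]

/-- Every nonzero isotropic vector without `e_r`-component represents a point. -/
lemma exists_pointRep {V : LieVec} (h0 : V ≠ 0) (hr : V.2.2.2 = 0) (hn : lieForm V V = 0) :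
    ∃ (p : E3hat) (c : ℝ), c ≠ 0 ∧ V = c • pointRep p := by
  obtain ⟨v, w, b, r⟩ := V
  obtain rfl : r = 0 := hr
  have hv : ‖v‖ ^ 2 = w * b := by
    simp only [lieForm, real_inner_self_eq_norm_sq] at hn
    linarith
  -- A vanishing `e₀`-coordinate forces the Euclidean part to vanish as well, which leaves the point
  -- at infinity.
  by_cases hw : w = 0
  · subst hw
    have : v = 0 := by
      rw [zero_mul, sq_eq_zero_iff, norm_eq_zero] at hv
      exact hv
    subst this
    refine ⟨OnePoint.infty, b, ?_, by simp [pointRep_infty]⟩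
    rintro rfl
    exact h0 rfl
  · refine ⟨((w⁻¹ • v : E3) : E3hat), w, hw, ?_⟩
    simp only [pointRep_coe, norm_smul, mul_pow, hv, Prod.smul_mk, smul_smul, mul_inv_cancel₀ hw,
      one_smul, smul_eq_mul, mul_one, mul_zero, norm_inv, Real.norm_eq_abs, inv_pow, sq_abs]
    congr 3
    field_simp

/-- Three pairwise non-orthogonal isotropic vectors are linearly independent. -/
lemma linearIndependent_of_isotropic {a : Fin 3 → LieVec} (h : ∀ i, lieForm (a i) (a i) = 0)
    (h01 : lieForm (a 0) (a 1) ≠ 0) (h02 : lieForm (a 0) (a 2) ≠ 0)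
    (h12 : lieForm (a 1) (a 2) ≠ 0) : LinearIndependent ℝ a := by
  rw [Fintype.linearIndependent_iff]
  intro g hg
  rw [Fin.sum_univ_three] at hg
  have key : ∀ w, g 0 * lieForm (a 0) w + g 1 * lieForm (a 1) w + g 2 * lieForm (a 2) w = 0 := by
    intro w
    rw [← lieForm_smul_left, ← lieForm_smul_left, ← lieForm_smul_left, ← lieForm_add_left,
      ← lieForm_add_left, hg, lieForm_zero_left]
  have k0 := key (a 0)
  have k1 := key (a 1)
  have k2 := key (a 2)
  rw [h, lieForm_comm (a 1) (a 0), lieForm_comm (a 2) (a 0)] at k0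
  rw [h, lieForm_comm (a 2) (a 1)] at k1
  rw [h] at k2
  generalize lieForm (a 0) (a 1) = x at *
  generalize lieForm (a 0) (a 2) = y at *
  generalize lieForm (a 1) (a 2) = z at *
  -- The Gram matrix has zero diagonal and determinant `2xyz`; the combination eliminates `g 1` and
  -- `g 2`.
  have e0 : g 0 = 0 := by
    have : g 0 * (2 * x * y) = 0 := by linear_combination x * k2 + y * k1 - z * k0
    simpa [h01, h02] using this
  have e1 : g 1 = 0 := by
    rw [e0] at k2
    simpa [h12] using k2
  have e2 : g 2 = 0 := by
    rw [e0] at k1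
    simpa [h12] using k1
  intro i
  fin_cases i
  exacts [e0, e1, e2]

lemma linearIndependent_pointRep {p q r : E3hat} (hpq : p ≠ q) (hpr : p ≠ r) (hqr : q ≠ r) :
    LinearIndependent ℝ ![pointRep p, pointRep q, pointRep r] := by
  refine linearIndependent_of_isotropic (fun i => ?_) ?_ ?_ ?_
  · fin_cases i <;> exact lieForm_pointRep_self _
  · exact fun h => hpq ((lieForm_pointRep_eq_zero_iff _ _).mp h)
  · exact fun h => hpr ((lieForm_pointRep_eq_zero_iff _ _).mp h)
  · exact fun h => hqr ((lieForm_pointRep_eq_zero_iff _ _).mp h)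

lemma range_vec3 {M : Type*} (a b c : M) : Set.range ![a, b, c] = {a, b, c} := by
  simp [Matrix.range_cons, Matrix.range_empty, Set.insert_comm, Set.union_singleton]
  ext x
  simp only [Set.mem_insert_iff, Set.mem_singleton_iff]
  tauto

/-- The span of the representatives of three points. -/
def circleSpan (p q r : E3hat) : Submodule ℝ LieVec :=
  Submodule.span ℝ {pointRep p, pointRep q, pointRep r}

lemma finrank_circleSpan {p q r : E3hat} (hpq : p ≠ q) (hpr : p ≠ r) (hqr : q ≠ r) :
    Module.finrank ℝ (circleSpan p q r) = 3 := by
  have := finrank_span_eq_card (linearIndependent_pointRep hpq hpr hqr)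
  rwa [range_vec3] at this

lemma circleSpan_le {U : Submodule ℝ LieVec} {p q r : E3hat} (hp : pointRep p ∈ U)
    (hq : pointRep q ∈ U) (hr : pointRep r ∈ U) : circleSpan p q r ≤ U := by
  refine Submodule.span_le.mpr ?_
  rintro _ (rfl | rfl | rfl) <;> assumption

lemma circleSpan_eq {U : Submodule ℝ LieVec} (hU : Module.finrank ℝ U ≤ 3) {p q r : E3hat}
    (hpq : p ≠ q) (hpr : p ≠ r) (hqr : q ≠ r) (hp : pointRep p ∈ U) (hq : pointRep q ∈ U)
    (hr : pointRep r ∈ U) : circleSpan p q r = U :=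
  Submodule.eq_of_le_of_finrank_le (circleSpan_le hp hq hr)
    (hU.trans (finrank_circleSpan hpq hpr hqr).ge)

lemma left_mem_circleSpan (p q r : E3hat) : pointRep p ∈ circleSpan p q r :=
  Submodule.subset_span (by simp)

lemma middle_mem_circleSpan (p q r : E3hat) : pointRep q ∈ circleSpan p q r :=
  Submodule.subset_span (by simp)

lemma right_mem_circleSpan (p q r : E3hat) : pointRep r ∈ circleSpan p q r :=
  Submodule.subset_span (by simp)

/-! ## Circles as plane sections -/

/-- The representatives of the points of a circle lie in a three-dimensional subspace. -/
lemma IsCircle.exists_submodule {K : Set E3hat} (hK : IsCircle K) :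
    ∃ U : Submodule ℝ LieVec, Module.finrank ℝ U ≤ 3 ∧ ∀ z ∈ K, pointRep z ∈ U := by
  have aux : ∀ (D : Submodule ℝ E3) (c : E3),
      ∃ D' : Submodule ℝ LieVec, Module.finrank ℝ D' ≤ Module.finrank ℝ D ∧
        ∀ v ∈ D, ((v, 0, 2 * inner ℝ c v, 0) : LieVec) ∈ D' := by
    intro D c
    -- The linear part of the lift: for `z = c + v` one has `‖z‖² = ‖c‖² + 2⟨c, v⟩ + ‖v‖²`. The
    -- remaining term `‖v‖²` is constant on a proper circle with centre `c`; on a line it is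
    -- absorbed by the representative of `∞`.
    let L : E3 →ₗ[ℝ] LieVec :=
      LinearMap.prod LinearMap.id (LinearMap.prod 0
        (LinearMap.prod ((2 : ℝ) • (innerSL ℝ c).toLinearMap) 0))
    refine ⟨D.map L, Submodule.finrank_map_le L D, fun v hv => ?_⟩
    exact Submodule.mem_map.mpr ⟨v, hv, rfl⟩
  rcases hK with ⟨A, c, r, hA, hc, hr, rfl⟩ | ⟨A, hA, rfl⟩
  · obtain ⟨D', hD', hmem⟩ := aux A.direction c
    refine ⟨Submodule.span ℝ {((c, 1, r ^ 2 + ‖c‖ ^ 2, 0) : LieVec)} ⊔ D', ?_, ?_⟩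
    · refine (Submodule.finrank_add_le_finrank_add_finrank _ _).trans ?_
      rw [finrank_span_singleton (by simp)]
      omega
    · rintro _ ⟨z, ⟨hz, hzr⟩, rfl⟩
      refine Submodule.mem_sup.mpr ⟨_, Submodule.mem_span_singleton_self _, _,
        hmem (z - c) (AffineSubspace.vsub_mem_direction hz hc), ?_⟩
      rw [dist_eq_norm] at hzr
      have h := norm_sub_sq_real z c
      rw [hzr] at h
      simp only [pointRep_coe, Prod.mk_add_mk, add_sub_cancel, add_zero, inner_sub_right,
        real_inner_self_eq_norm_sq, real_inner_comm z c] at h ⊢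
      congr 3
      rw [h]
      ring
  · have hne : (A : Set E3).Nonempty := by
      rw [Set.nonempty_iff_ne_empty]
      intro h
      rw [AffineSubspace.coe_eq_bot_iff] at h
      rw [h, AffineSubspace.direction_bot, finrank_bot] at hA
      exact zero_ne_one hA
    obtain ⟨c, hc⟩ := hne
    obtain ⟨D', hD', hmem⟩ := aux A.direction c
    refine ⟨Submodule.span ℝ {pointRep (c : E3hat)} ⊔
      (Submodule.span ℝ {pointRep OnePoint.infty} ⊔ D'), ?_, ?_⟩
    · refine (Submodule.finrank_add_le_finrank_add_finrank _ _).trans ?_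
      have h1 := finrank_span_singleton (K := ℝ) (pointRep_ne_zero (c : E3hat))
      have h2 := finrank_span_singleton (K := ℝ) (pointRep_ne_zero OnePoint.infty)
      have h3 := Submodule.finrank_add_le_finrank_add_finrank
        (Submodule.span ℝ {pointRep OnePoint.infty}) D'
      omega
    · rintro z (rfl | ⟨z, hz, rfl⟩)
      · exact Submodule.mem_sup_right
          (Submodule.mem_sup_left (Submodule.mem_span_singleton_self _))
      · refine Submodule.mem_sup.mpr ⟨_, Submodule.mem_span_singleton_self _, _,
          Submodule.add_mem_sup (Submodule.smul_mem _ (‖z - c‖ ^ 2)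
            (Submodule.mem_span_singleton_self _))
            (hmem (z - c) (AffineSubspace.vsub_mem_direction hz hc)), ?_⟩
        have h := norm_sub_sq_real z c
        simp only [pointRep_coe, pointRep_infty, Prod.mk_add_mk, add_sub_cancel, add_zero,
          inner_sub_right, real_inner_self_eq_norm_sq, real_inner_comm z c, Prod.smul_mk, zero_add,
          smul_zero, smul_eq_mul, mul_zero, mul_one, h]
        congr 3
        ring

lemma Concircular.pointRep_mem {S : Set E3hat} (hS : Concircular S) {p q r z : E3hat}
    (hpq : p ≠ q) (hpr : p ≠ r) (hqr : q ≠ r) (hp : p ∈ S) (hq : q ∈ S) (hr : r ∈ S)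
    (hz : z ∈ S) : pointRep z ∈ circleSpan p q r := by
  obtain ⟨K, hK, hSK⟩ := hS
  obtain ⟨U, hU, hmem⟩ := hK.exists_submodule
  rw [circleSpan_eq hU hpq hpr hqr (hmem _ (hSK hp)) (hmem _ (hSK hq)) (hmem _ (hSK hr))]
  exact hmem _ (hSK hz)

lemma exists_line {p q : E3} (hpq : p ≠ q) :
    ∃ K, IsCircle K ∧
      ∀ z, pointRep z ∈ circleSpan OnePoint.infty (p : E3hat) (q : E3hat) → z ∈ K := by
  refine ⟨_, Or.inr ⟨AffineSubspace.mk' p (Submodule.span ℝ {q - p}), ?_, rfl⟩, ?_⟩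
  · rw [AffineSubspace.direction_mk']
    exact finrank_span_singleton (sub_ne_zero.mpr hpq.symm)
  · intro z hz
    induction z using OnePoint.rec with
    | infty => exact Set.mem_insert _ _
    | coe z =>
      refine Set.mem_insert_of_mem _ ⟨z, ?_, rfl⟩
      obtain ⟨a, b, c, h⟩ := Submodule.mem_span_triple.mp hz
      simp only [pointRep_coe, pointRep_infty, Prod.smul_mk, Prod.mk_add_mk, Prod.mk.injEq,
        smul_zero, zero_add, smul_eq_mul, mul_one, mul_zero] at h
      obtain ⟨h1, h2, -, -⟩ := h
      refine (AffineSubspace.mem_mk').mpr (Submodule.mem_span_singleton.mpr ⟨c, ?_⟩)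
      rw [vsub_eq_sub, ← h1, show b = 1 - c by linarith]
      module

lemma exists_circle {p q r : E3} (hpq : p ≠ q) (hpr : p ≠ r) (hqr : q ≠ r)
    (hinf : pointRep OnePoint.infty ∉ circleSpan (p : E3hat) (q : E3hat) (r : E3hat)) :
    ∃ K, IsCircle K ∧
      ∀ z, pointRep z ∈ circleSpan (p : E3hat) (q : E3hat) (r : E3hat) → z ∈ K := by
  have hli := linearIndependent_pointRep (OnePoint.coe_injective.ne hpq)
    (OnePoint.coe_injective.ne hpr) (OnePoint.coe_injective.ne hqr)
  have hind : AffineIndependent ℝ ![p, q, r] := by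
    rw [affineIndependent_iff_of_fintype]
    intro w hw hw'
    rw [Finset.univ.weightedVSub_eq_linear_combination hw] at hw'
    rw [Fin.sum_univ_three] at hw hw'
    simp only [Matrix.cons_val_zero, Matrix.cons_val_one, Matrix.cons_val] at hw'
    -- An affine dependence of the points makes the same combination of their representatives a
    -- multiple of that of `∞`. As `∞` is not in the span, the multiple is zero, and linear
    -- independence applies.
    have hsum : w 0 • pointRep (p : E3hat) + w 1 • pointRep (q : E3hat) + w 2 • pointRep (r : E3hat)
        = (w 0 * ‖p‖ ^ 2 + w 1 * ‖q‖ ^ 2 + w 2 * ‖r‖ ^ 2) • pointRep OnePoint.infty := by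
      simp [pointRep_coe, pointRep_infty, hw, hw']
    have h0 : w 0 * ‖p‖ ^ 2 + w 1 * ‖q‖ ^ 2 + w 2 * ‖r‖ ^ 2 = 0 := by
      by_contra hne
      apply hinf
      rw [← Submodule.smul_mem_iff _ hne, ← hsum]
      exact Submodule.mem_span_triple.mpr ⟨_, _, _, rfl⟩
    rw [h0, zero_smul] at hsum
    rw [Fintype.linearIndependent_iff] at hli
    refine hli w ?_
    rw [Fin.sum_univ_three]
    exact hsum
  obtain ⟨⟨c, ρ⟩, ⟨hc, hρ⟩, -⟩ := hind.existsUnique_dist_eq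
  simp only at hc hρ
  have hd : ∀ i, dist (![p, q, r] i) c = ρ := fun i => hρ (Set.mem_range_self i)
  have hp := hd 0
  have hq := hd 1
  have hr := hd 2
  simp only [Matrix.cons_val_zero, Matrix.cons_val_one, Matrix.cons_val] at hp hq hr
  refine ⟨_, Or.inl ⟨affineSpan ℝ (Set.range ![p, q, r]), c, ρ, ?_, hc, ?_, rfl⟩, ?_⟩
  · rw [direction_affineSpan]
    exact hind.finrank_vectorSpan (by simp)
  · refine lt_of_le_of_ne (hp ▸ dist_nonneg) fun h => hpq ?_
    rw [← h] at hp hq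
    rw [dist_eq_zero.mp hp, dist_eq_zero.mp hq]
  · intro z hz
    induction z using OnePoint.rec with
    | infty => exact absurd hz hinf
    | coe z =>
      refine ⟨z, ?_, rfl⟩
      obtain ⟨α, β, γ, h⟩ := Submodule.mem_span_triple.mp hz
      simp only [pointRep_coe, Prod.smul_mk, Prod.mk_add_mk, Prod.mk.injEq, smul_eq_mul, mul_one,
        mul_zero] at h
      obtain ⟨h1, h2, h3, -⟩ := h
      have hα : α = 1 - β - γ := by linarith
      constructor
      · have hpm : p ∈ affineSpan ℝ (Set.range ![p, q, r]) := mem_affineSpan ℝ ⟨0, rfl⟩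
        have hqm : q ∈ affineSpan ℝ (Set.range ![p, q, r]) := mem_affineSpan ℝ ⟨1, rfl⟩
        have hrm : r ∈ affineSpan ℝ (Set.range ![p, q, r]) := mem_affineSpan ℝ ⟨2, rfl⟩
        have hz' : z = (β • (q - p) + γ • (r - p)) + p := by
          rw [← h1, hα]
          module
        rw [hz']
        exact AffineSubspace.vadd_mem_of_mem_direction (Submodule.add_mem _
          (Submodule.smul_mem _ _ (AffineSubspace.vsub_mem_direction hqm hpm))
          (Submodule.smul_mem _ _ (AffineSubspace.vsub_mem_direction hrm hpm))) hpm
      · have hρ0 : 0 ≤ ρ := hp ▸ dist_nonneg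
        rw [dist_eq_norm] at hp hq hr ⊢
        rw [← sq_eq_sq₀ (norm_nonneg _) hρ0]
        have ep := norm_sub_sq_real p c
        have eq := norm_sub_sq_real q c
        have er := norm_sub_sq_real r c
        rw [hp] at ep
        rw [hq] at eq
        rw [hr] at er
        rw [norm_sub_sq_real, ← h3, ← h1]
        simp only [inner_add_left, real_inner_smul_left]
        rw [hα]
        linear_combination (-(1 - β - γ)) * ep - β * eq - γ * er

/-- The points represented in the span of three points form a circle. -/
lemma concircular_of_mem_circleSpan {S : Set E3hat} {p q r : E3hat} (hpq : p ≠ q) (hpr : p ≠ r)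
    (hqr : q ≠ r) (hS : ∀ z ∈ S, pointRep z ∈ circleSpan p q r) : Concircular S := by
  suffices ∃ K, IsCircle K ∧ ∀ z, pointRep z ∈ circleSpan p q r → z ∈ K by
    obtain ⟨K, hK, h⟩ := this
    exact ⟨K, hK, fun z hz => h z (hS z hz)⟩
  have hrank := (finrank_circleSpan hpq hpr hqr).le
  -- The span contains `∞` exactly in the case of a line, and two finite points among `p`, `q`, `r`
  -- then determine it.
  by_cases hinf : pointRep OnePoint.infty ∈ circleSpan p q r
  · have key : ∀ a b : E3, (a : E3hat) ≠ b → pointRep (a : E3hat) ∈ circleSpan p q r →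
        pointRep (b : E3hat) ∈ circleSpan p q r →
        ∃ K, IsCircle K ∧ ∀ z, pointRep z ∈ circleSpan p q r → z ∈ K := by
      intro a b hab ha hb
      rw [← circleSpan_eq hrank (OnePoint.infty_ne_coe a) (OnePoint.infty_ne_coe b) hab hinf ha hb]
      exact exists_line fun h => hab (h ▸ rfl)
    have hp := left_mem_circleSpan p q r
    have hq := middle_mem_circleSpan p q r
    have hr := right_mem_circleSpan p q r
    by_cases hpi : p = OnePoint.infty
    · obtain ⟨b, hb⟩ := OnePoint.ne_infty_iff_exists.mp (fun h => hpq (hpi.trans h.symm))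
      obtain ⟨c, hc⟩ := OnePoint.ne_infty_iff_exists.mp (fun h => hpr (hpi.trans h.symm))
      exact key b c (by rwa [hb, hc]) (by rwa [hb]) (by rwa [hc])
    · obtain ⟨a, ha⟩ := OnePoint.ne_infty_iff_exists.mp hpi
      by_cases hqi : q = OnePoint.infty
      · obtain ⟨c, hc⟩ := OnePoint.ne_infty_iff_exists.mp (fun h => hqr (hqi.trans h.symm))
        exact key a c (by rwa [ha, hc]) (by rwa [ha]) (by rwa [hc])
      · obtain ⟨b, hb⟩ := OnePoint.ne_infty_iff_exists.mp hqi
        exact key a b (by rwa [ha, hb]) (by rwa [ha]) (by rwa [hb])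
  · have hfin : ∀ s, pointRep s ∈ circleSpan p q r → ∃ a : E3, (a : E3hat) = s := by
      intro s hs
      refine OnePoint.ne_infty_iff_exists.mp ?_
      rintro rfl
      exact hinf hs
    obtain ⟨a, rfl⟩ := hfin p (left_mem_circleSpan p q r)
    obtain ⟨b, rfl⟩ := hfin q (middle_mem_circleSpan _ q r)
    obtain ⟨c, rfl⟩ := hfin r (right_mem_circleSpan _ _ r)
    exact exists_circle (fun h => hpq (h ▸ rfl)) (fun h => hpr (h ▸ rfl)) (fun h => hqr (h ▸ rfl))
      hinf

/-! ## Miquel's theorem -/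

/-- Three points of `ℝ³ ∪ {∞}` represented in a common plane spanned by two of them are not
distinct. -/
lemma pointRep_ne_comb {p q r : E3hat} (hpq : p ≠ q) (hpr : p ≠ r) (hqr : q ≠ r) (b c : ℝ) :
    pointRep p ≠ b • pointRep q + c • pointRep r := by
  intro h
  have := linearIndependent_pointRep hpq hpr hqr
  rw [Fintype.linearIndependent_iff] at this
  have h2 := this ![1, -b, -c] (by
    rw [Fin.sum_univ_three]
    simp [h])
  simpa using h2 0

/-- A fourth point of a circle has nonzero coordinates with respect to three points. -/
lemma exists_coeff {p q r z : E3hat} (hpq : p ≠ q) (hpr : p ≠ r) (hqr : q ≠ r) (hzp : z ≠ p)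
    (hzq : z ≠ q) (hzr : z ≠ r) (hz : pointRep z ∈ circleSpan p q r) :
    ∃ a b c : ℝ, a ≠ 0 ∧ b ≠ 0 ∧ c ≠ 0 ∧
      pointRep z = a • pointRep p + b • pointRep q + c • pointRep r := by
  obtain ⟨a, b, c, h⟩ := Submodule.mem_span_triple.mp hz
  refine ⟨a, b, c, ?_, ?_, ?_, h.symm⟩ <;> rintro rfl
  · exact pointRep_ne_comb hzq hzr hqr b c (by rw [← h]; simp)
  · exact pointRep_ne_comb hzp hzr hpr a c (by rw [← h]; simp)
  · exact pointRep_ne_comb hzp hzq hpq a b (by rw [← h]; simp)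

/-- Three circular quadrilaterals `(x, y₁, z₀, y₂)`, `(x, y₂, z₁, y₀)`, `(x, y₀, z₂, y₁)` with a
common vertex that do not lie on a common circle. -/
structure IsCorner (x y₀ y₁ y₂ z₀ z₁ z₂ : E3hat) : Prop where
  xy₀ : x ≠ y₀
  xy₁ : x ≠ y₁
  xy₂ : x ≠ y₂
  y₀₁ : y₀ ≠ y₁
  y₁₂ : y₁ ≠ y₂
  y₂₀ : y₂ ≠ y₀
  z₀x : z₀ ≠ x
  z₁x : z₁ ≠ x
  z₂x : z₂ ≠ x
  z₀y₁ : z₀ ≠ y₁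
  z₀y₂ : z₀ ≠ y₂
  z₁y₂ : z₁ ≠ y₂
  z₁y₀ : z₁ ≠ y₀
  z₂y₀ : z₂ ≠ y₀
  z₂y₁ : z₂ ≠ y₁
  mem₀ : pointRep z₀ ∈ circleSpan x y₁ y₂
  mem₁ : pointRep z₁ ∈ circleSpan x y₂ y₀
  mem₂ : pointRep z₂ ∈ circleSpan x y₀ y₁
  not_concircular : ¬ Concircular {x, y₀, y₁, y₂, z₀, z₁, z₂}

namespace IsCorner

variable {x y₀ y₁ y₂ z₀ z₁ z₂ : E3hat}

lemma rotate (h : IsCorner x y₀ y₁ y₂ z₀ z₁ z₂) : IsCorner x y₁ y₂ y₀ z₁ z₂ z₀ where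
  xy₀ := h.xy₁
  xy₁ := h.xy₂
  xy₂ := h.xy₀
  y₀₁ := h.y₁₂
  y₁₂ := h.y₂₀
  y₂₀ := h.y₀₁
  z₀x := h.z₁x
  z₁x := h.z₂x
  z₂x := h.z₀x
  z₀y₁ := h.z₁y₂
  z₀y₂ := h.z₁y₀
  z₁y₂ := h.z₂y₀
  z₁y₀ := h.z₂y₁
  z₂y₀ := h.z₀y₁
  z₂y₁ := h.z₀y₂
  mem₀ := h.mem₁
  mem₁ := h.mem₂
  mem₂ := h.mem₀
  not_concircular := by
    have : ({x, y₁, y₂, y₀, z₁, z₂, z₀} : Set E3hat) = {x, y₀, y₁, y₂, z₀, z₁, z₂} := by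
      ext p
      simp only [Set.mem_insert_iff, Set.mem_singleton_iff]
      tauto
    rw [this]
    exact h.not_concircular

/-- Since each `zᵢ` lies in a span of `x` and two of the `yⱼ`, a three-dimensional subspace
containing `x` and all `yⱼ` would contain all seven points, which would then be concircular. -/
lemma notMem (h : IsCorner x y₀ y₁ y₂ z₀ z₁ z₂) {U : Submodule ℝ LieVec}
    (hU : Module.finrank ℝ U ≤ 3) (hx : pointRep x ∈ U) (h₀ : pointRep y₀ ∈ U)
    (h₁ : pointRep y₁ ∈ U) : pointRep y₂ ∉ U := by
  intro h₂
  refine h.not_concircular (concircular_of_mem_circleSpan h.xy₀ h.xy₁ h.y₀₁ ?_)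
  rw [circleSpan_eq hU h.xy₀ h.xy₁ h.y₀₁ hx h₀ h₁]
  rintro z (rfl | rfl | rfl | rfl | rfl | rfl | rfl)
  exacts [hx, h₀, h₁, h₂, circleSpan_le hx h₁ h₂ h.mem₀, circleSpan_le hx h₂ h₀ h.mem₁,
    circleSpan_le hx h₀ h₁ h.mem₂]

lemma linearIndependent (h : IsCorner x y₀ y₁ y₂ z₀ z₁ z₂) {a b₀ b₁ b₂ : ℝ}
    (h0 : a • pointRep x + b₀ • pointRep y₀ + b₁ • pointRep y₁ + b₂ • pointRep y₂ = 0) :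
    a = 0 ∧ b₀ = 0 ∧ b₁ = 0 ∧ b₂ = 0 := by
  have hb₂ : b₂ = 0 := by
    by_contra hne
    refine h.notMem (finrank_circleSpan h.xy₀ h.xy₁ h.y₀₁).le (left_mem_circleSpan _ _ _)
      (middle_mem_circleSpan _ _ _) (right_mem_circleSpan _ _ _) ?_
    rw [← Submodule.smul_mem_iff _ hne, eq_neg_of_add_eq_zero_right h0]
    exact Submodule.neg_mem _ (Submodule.mem_span_triple.mpr ⟨_, _, _, rfl⟩)
  subst hb₂
  have := linearIndependent_pointRep h.xy₀ h.xy₁ h.y₀₁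
  rw [Fintype.linearIndependent_iff] at this
  have h2 := this ![a, b₀, b₁] (by
    rw [Fin.sum_univ_three]
    simpa using h0)
  exact ⟨h2 0, h2 1, h2 2, rfl⟩

lemma z₀_ne_z₁ (h : IsCorner x y₀ y₁ y₂ z₀ z₁ z₂) : z₀ ≠ z₁ := by
  rintro rfl
  obtain ⟨a, b, c, -, hb, -, e⟩ := exists_coeff h.xy₁ h.xy₂ h.y₁₂ h.z₀x h.z₀y₁ h.z₀y₂ h.mem₀
  obtain ⟨a', b', c', -, -, -, e'⟩ := exists_coeff h.xy₂ h.xy₀ h.y₂₀ h.z₁x h.z₁y₂ h.z₁y₀ h.mem₁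
  refine hb (h.linearIndependent (a := a - a') (b₀ := -c') (b₁ := b) (b₂ := c - b') ?_).2.2.1
  linear_combination (norm := module) e' - e

/-- The candidate is `P = α X + β₀ Y₀ + β₁ Y₁ + β₂ Y₂`. Row `i` of `M` is the linear condition that
`P` lies in the span of the circle through `yᵢ` and the two adjacent `zⱼ`. Three equations in four
unknowns have a nonzero solution, and isotropy of `P` comes for free. -/
lemma exists_eighth (h : IsCorner x y₀ y₁ y₂ z₀ z₁ z₂) :
    ∃ p, pointRep p ∈ circleSpan y₀ z₂ z₁ ∧ pointRep p ∈ circleSpan y₁ z₀ z₂ ∧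
      pointRep p ∈ circleSpan y₂ z₁ z₀ := by
  obtain ⟨a₀, b₀, c₀, ha₀, hb₀, hc₀, e₀⟩ :=
    exists_coeff h.xy₁ h.xy₂ h.y₁₂ h.z₀x h.z₀y₁ h.z₀y₂ h.mem₀
  obtain ⟨a₁, b₁, c₁, ha₁, hb₁, hc₁, e₁⟩ :=
    exists_coeff h.xy₂ h.xy₀ h.y₂₀ h.z₁x h.z₁y₂ h.z₁y₀ h.mem₁
  obtain ⟨a₂, b₂, c₂, ha₂, hb₂, hc₂, e₂⟩ :=
    exists_coeff h.xy₀ h.xy₁ h.y₀₁ h.z₂x h.z₂y₀ h.z₂y₁ h.mem₂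
  let M : Matrix (Fin 3) (Fin 4) ℝ :=
    !![1, 0, -(a₂ / c₂), -(a₁ / b₁); 1, -(a₂ / b₂), 0, -(a₀ / c₀); 1, -(a₁ / c₁), -(a₀ / b₀), 0]
  have hker : LinearMap.ker M.mulVecLin ≠ ⊥ := by
    refine LinearMap.ker_ne_bot_of_finrank_lt ?_
    simp
  obtain ⟨v, hv, hv0⟩ := (Submodule.ne_bot_iff _).mp hker
  rw [LinearMap.mem_ker, Matrix.mulVecLin_apply] at hv
  have k₀ := congrFun hv 0
  have k₁ := congrFun hv 1
  have k₂ := congrFun hv 2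
  simp only [M, Matrix.mulVec, dotProduct, Fin.sum_univ_four, Matrix.of_apply,
    Matrix.cons_val_zero, Matrix.cons_val_one, Matrix.cons_val, Pi.zero_apply] at k₀ k₁ k₂
  have hvne : ¬ (v 0 = 0 ∧ v 1 = 0 ∧ v 2 = 0 ∧ v 3 = 0) := by
    rintro ⟨h0, h1, h2, h3⟩
    apply hv0
    funext i
    fin_cases i
    exacts [h0, h1, h2, h3]
  generalize v 0 = α at *
  generalize v 1 = β₀ at *
  generalize v 2 = β₁ at *
  generalize v 3 = β₂ at *
  set X := pointRep x
  set Y₀ := pointRep y₀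
  set Y₁ := pointRep y₁
  set Y₂ := pointRep y₂
  have n₀ := lieForm_pointRep_self z₀
  have n₁ := lieForm_pointRep_self z₁
  have n₂ := lieForm_pointRep_self z₂
  have nX : lieForm X X = 0 := lieForm_pointRep_self x
  have nY₀ : lieForm Y₀ Y₀ = 0 := lieForm_pointRep_self y₀
  have nY₁ : lieForm Y₁ Y₁ = 0 := lieForm_pointRep_self y₁
  have nY₂ : lieForm Y₂ Y₂ = 0 := lieForm_pointRep_self y₂
  rw [e₀] at n₀
  rw [e₁] at n₁
  rw [e₂] at n₂
  let P : LieVec := α • X + β₀ • Y₀ + β₁ • Y₁ + β₂ • Y₂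
  have hP0 : P ≠ 0 := fun h0 => hvne (h.linearIndependent h0)
  have hPr : P.2.2.2 = 0 := by
    simp [P, X, Y₀, Y₁, Y₂, pointRep_r]
  have hPn : lieForm P P = 0 := by
    simp only [P, lieForm_add_left, lieForm_add_right, lieForm_smul_left, lieForm_smul_right, nX,
      nY₀, nY₁, nY₂, lieForm_comm Y₀ X, lieForm_comm Y₁ X, lieForm_comm Y₂ X, lieForm_comm Y₁ Y₀,
      lieForm_comm Y₂ Y₀, lieForm_comm Y₂ Y₁] at n₀ n₁ n₂ ⊢
    -- Isotropy of each `zᵢ` expresses the products of the `Yⱼ` by their products with `X`. After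
    -- substitution, the coefficient of `⟨X, Yᵢ⟩` in `⟨P, P⟩` is `2βᵢ` times row `i`.
    have m₀ : lieForm Y₁ Y₂ = -(a₀ / c₀) * lieForm X Y₁ - (a₀ / b₀) * lieForm X Y₂ := by
      field_simp
      linarith
    have m₁ : lieForm Y₀ Y₂ = -(a₁ / c₁) * lieForm X Y₂ - (a₁ / b₁) * lieForm X Y₀ := by
      field_simp
      linarith
    have m₂ : lieForm Y₀ Y₁ = -(a₂ / c₂) * lieForm X Y₀ - (a₂ / b₂) * lieForm X Y₁ := by
      field_simp
      linarith
    rw [m₀, m₁, m₂]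
    linear_combination (2 * β₀ * lieForm X Y₀) * k₀ + (2 * β₁ * lieForm X Y₁) * k₁ +
      (2 * β₂ * lieForm X Y₂) * k₂
  obtain ⟨p, c, hc, hp⟩ := exists_pointRep hP0 hPr hPn
  have aux : ∀ U : Submodule ℝ LieVec, P ∈ U → pointRep p ∈ U := by
    intro U hU
    rwa [hp, Submodule.smul_mem_iff _ hc] at hU
  refine ⟨p, aux _ ?_, aux _ ?_, aux _ ?_⟩
  -- In this span `Y₁` occurs only in `z₂` and `Y₂` only in `z₁`, which fixes two coefficients; that
  -- of `Y₀` is adjusted freely, and the row equation matches the coefficient of `X`.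
  · refine Submodule.mem_span_triple.mpr
      ⟨β₀ - β₁ / c₂ * b₂ - β₂ / b₁ * c₁, β₁ / c₂, β₂ / b₁, ?_⟩
    rw [e₁, e₂]
    have hα : α = β₁ / c₂ * a₂ + β₂ / b₁ * a₁ := by linear_combination k₀
    have h1 : β₁ / c₂ * c₂ = β₁ := div_mul_cancel₀ _ hc₂
    have h2 : β₂ / b₁ * b₁ = β₂ := div_mul_cancel₀ _ hb₁
    simp only [P]
    linear_combination (norm := module) h1 • Y₁ + h2 • Y₂ - hα • X
  · refine Submodule.mem_span_triple.mpr
      ⟨β₁ - β₂ / c₀ * b₀ - β₀ / b₂ * c₂, β₂ / c₀, β₀ / b₂, ?_⟩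
    rw [e₀, e₂]
    have hα : α = β₂ / c₀ * a₀ + β₀ / b₂ * a₂ := by linear_combination k₁
    have h1 : β₂ / c₀ * c₀ = β₂ := div_mul_cancel₀ _ hc₀
    have h2 : β₀ / b₂ * b₂ = β₀ := div_mul_cancel₀ _ hb₂
    simp only [P]
    linear_combination (norm := module) h1 • Y₂ + h2 • Y₀ - hα • X
  · refine Submodule.mem_span_triple.mpr
      ⟨β₂ - β₀ / c₁ * b₁ - β₁ / b₀ * c₀, β₀ / c₁, β₁ / b₀, ?_⟩
    rw [e₀, e₁]
    have hα : α = β₀ / c₁ * a₁ + β₁ / b₀ * a₀ := by linear_combination k₂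
    have h1 : β₀ / c₁ * c₁ = β₀ := div_mul_cancel₀ _ hc₁
    have h2 : β₁ / b₀ * b₀ = β₁ := div_mul_cancel₀ _ hb₀
    simp only [P]
    linear_combination (norm := module) h1 • Y₀ + h2 • Y₁ - hα • X

/-- A point of intersection of two of the remaining face circles is one of two common points. -/
lemma z₀_eq_or (h : IsCorner x y₀ y₁ y₂ z₀ z₁ z₂) {p q : E3hat} (hpq : p ≠ q)
    (hp₁ : pointRep p ∈ circleSpan y₁ z₀ z₂) (hp₂ : pointRep p ∈ circleSpan y₂ z₁ z₀)
    (hq₁ : pointRep q ∈ circleSpan y₁ z₀ z₂) (hq₂ : pointRep q ∈ circleSpan y₂ z₁ z₀) :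
    z₀ = p ∨ z₀ = q := by
  by_contra! hne
  have r₁ := finrank_circleSpan h.z₀y₁.symm h.z₂y₁.symm h.rotate.rotate.z₀_ne_z₁.symm
  have r₂ := finrank_circleSpan h.z₁y₂.symm h.z₀y₂.symm h.z₀_ne_z₁.symm
  -- Three common points `p`, `q`, `z₀` make the two circles equal. Their span `U` then contains
  -- `y₁`, `y₂`, `z₀`, `z₂`, hence also `x` by `e₀` and `y₀` by `e₂`, contrary to `notMem`.
  have s₁ := circleSpan_eq r₁.le hpq hne.1.symm hne.2.symm hp₁ hq₁ (middle_mem_circleSpan _ _ _)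
  have s₂ := circleSpan_eq r₂.le hpq hne.1.symm hne.2.symm hp₂ hq₂ (right_mem_circleSpan _ _ _)
  have hy₁ := left_mem_circleSpan y₁ z₀ z₂
  have hz₀ := middle_mem_circleSpan y₁ z₀ z₂
  have hz₂ := right_mem_circleSpan y₁ z₀ z₂
  have hy₂ := left_mem_circleSpan y₂ z₁ z₀
  rw [← s₂, s₁] at hy₂
  obtain ⟨a₀, b₀, c₀, ha₀, hb₀, hc₀, e₀⟩ :=
    exists_coeff h.xy₁ h.xy₂ h.y₁₂ h.z₀x h.z₀y₁ h.z₀y₂ h.mem₀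
  obtain ⟨a₂, b₂, c₂, ha₂, hb₂, hc₂, e₂⟩ :=
    exists_coeff h.xy₀ h.xy₁ h.y₀₁ h.z₂x h.z₂y₀ h.z₂y₁ h.mem₂
  generalize circleSpan y₁ z₀ z₂ = U at *
  have hx : pointRep x ∈ U := by
    rw [← Submodule.smul_mem_iff _ ha₀]
    have : a₀ • pointRep x = pointRep z₀ - b₀ • pointRep y₁ - c₀ • pointRep y₂ := by
      rw [e₀]
      abel
    rw [this]
    exact Submodule.sub_mem _ (Submodule.sub_mem _ hz₀ (Submodule.smul_mem _ _ hy₁))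
      (Submodule.smul_mem _ _ hy₂)
  have hy₀ : pointRep y₀ ∈ U := by
    rw [← Submodule.smul_mem_iff _ hb₂]
    have : b₂ • pointRep y₀ = pointRep z₂ - a₂ • pointRep x - c₂ • pointRep y₁ := by
      rw [e₂]
      abel
    rw [this]
    exact Submodule.sub_mem _ (Submodule.sub_mem _ hz₂ (Submodule.smul_mem _ _ hx))
      (Submodule.smul_mem _ _ hy₁)
  exact h.notMem r₁.le hx hy₀ hy₁ hy₂

/-- Miquel's theorem: the eighth vertex exists and is unique. -/
theorem existsUnique_eighth (h : IsCorner x y₀ y₁ y₂ z₀ z₁ z₂) :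
    ∃! p, Concircular {y₀, z₂, p, z₁} ∧ Concircular {y₁, z₀, p, z₂} ∧
      Concircular {y₂, z₁, p, z₀} := by
  have h01 := h.z₀_ne_z₁
  have h12 := h.rotate.z₀_ne_z₁
  have h20 := h.rotate.rotate.z₀_ne_z₁
  have hiff : ∀ {a b c p : E3hat}, a ≠ b → a ≠ c → b ≠ c →
      (Concircular {a, b, p, c} ↔ pointRep p ∈ circleSpan a b c) := by
    intro a b c p hab hac hbc
    refine ⟨fun hc => hc.pointRep_mem hab hac hbc (by simp) (by simp) (by simp) (by simp),
      fun hp => concircular_of_mem_circleSpan hab hac hbc ?_⟩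
    rintro z (rfl | rfl | rfl | rfl)
    exacts [left_mem_circleSpan _ _ _, middle_mem_circleSpan _ _ _, hp, right_mem_circleSpan _ _ _]
  simp only [hiff h.z₂y₀.symm h.z₁y₀.symm h12.symm, hiff h.z₀y₁.symm h.z₂y₁.symm h20.symm,
    hiff h.z₁y₂.symm h.z₀y₂.symm h01.symm]
  obtain ⟨p, hp₀, hp₁, hp₂⟩ := h.exists_eighth
  refine ⟨p, ⟨hp₀, hp₁, hp₂⟩, ?_⟩
  rintro q ⟨hq₀, hq₁, hq₂⟩
  by_contra hqp
  have k₀ := h.z₀_eq_or hqp hq₁ hq₂ hp₁ hp₂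
  have k₁ := h.rotate.z₀_eq_or hqp hq₂ hq₀ hp₂ hp₀
  have k₂ := h.rotate.rotate.z₀_eq_or hqp hq₀ hq₁ hp₀ hp₁
  -- The three distinct points `z₀`, `z₁`, `z₂` cannot all lie in `{p, q}`.
  grind

end IsCorner

/-! ## Curves in homogeneous coordinates -/

/-- A normalization of the homogeneous coordinates of points. -/
def normalize (V : LieVec) : LieVec := (V.2.1 + V.2.2.1)⁻¹ • V

lemma pointRep_weight_ne_zero (p : E3hat) : (pointRep p).2.1 + (pointRep p).2.2.1 ≠ 0 := by
  induction p using OnePoint.rec with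
  | infty => simp [pointRep_infty]
  | coe x => simp only [pointRep_coe]; positivity

lemma normalize_smul {c : ℝ} (hc : c ≠ 0) (V : LieVec) : normalize (c • V) = normalize V := by
  simp only [normalize, Prod.smul_snd, Prod.smul_fst, smul_eq_mul, smul_smul]
  congr 1
  rw [← mul_add, mul_inv]
  field_simp

lemma normalize_pointRep_injective : Function.Injective fun p : E3hat => normalize (pointRep p) := by
  intro p q h
  have hp := pointRep_weight_ne_zero p
  refine eq_of_pointRep_eq_smul (c := ((pointRep p).2.1 + (pointRep p).2.2.1) *
    ((pointRep q).2.1 + (pointRep q).2.2.1)⁻¹) ?_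
  have h2 := congrArg (((pointRep p).2.1 + (pointRep p).2.2.1) • ·) h
  simp only [normalize, smul_smul, mul_inv_cancel₀ hp, one_smul] at h2
  exact h2

/-- For finite points the weight is `1 + ‖x‖²`, and at `∞` it is 1, so it never vanishes. This is
stereographic projection in affine disguise; by compactness it is an embedding, which lets
continuity be tested on homogeneous coordinates. -/
lemma continuous_normalize_pointRep : Continuous fun p : E3hat => normalize (pointRep p) := by
  rw [continuous_iff_continuousAt]
  intro p
  induction p using OnePoint.rec with
  | infty =>
    rw [OnePoint.continuousAt_infty', coclosedCompact_eq_cocompact]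
    have hn : Tendsto (fun x : E3 => ‖x‖) (cocompact E3) atTop := tendsto_norm_cocompact_atTop
    have hsq : Tendsto (fun x : E3 => 1 + ‖x‖ ^ 2) (cocompact E3) atTop :=
      tendsto_atTop_add_const_left _ _ ((tendsto_pow_atTop two_ne_zero).comp hn)
    have hinv : Tendsto (fun x : E3 => (1 + ‖x‖ ^ 2)⁻¹) (cocompact E3) (𝓝 0) :=
      tendsto_inv_atTop_zero.comp hsq
    have h1 : Tendsto (fun x : E3 => (1 + ‖x‖ ^ 2)⁻¹ • x) (cocompact E3) (𝓝 0) := by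
      rw [tendsto_zero_iff_norm_tendsto_zero]
      refine squeeze_zero' (Eventually.of_forall fun _ => norm_nonneg _) ?_
        (tendsto_inv_atTop_zero.comp hn)
      filter_upwards [hn.eventually_gt_atTop 0] with x hx
      rw [norm_smul, norm_inv, Real.norm_of_nonneg (by positivity)]
      simp only [Function.comp]
      rw [inv_mul_le_iff₀ (by positivity)]
      field_simp
      linarith
    have h2 : Tendsto (fun x : E3 => (1 + ‖x‖ ^ 2)⁻¹ * ‖x‖ ^ 2) (cocompact E3) (𝓝 1) := by
      have : (fun x : E3 => (1 + ‖x‖ ^ 2)⁻¹ * ‖x‖ ^ 2) = fun x => 1 - (1 + ‖x‖ ^ 2)⁻¹ := by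
        funext x
        have : 1 + ‖x‖ ^ 2 ≠ 0 := by positivity
        field_simp
        ring
      rw [this]
      simpa using (tendsto_const_nhds (x := (1 : ℝ))).sub hinv
    have h3 := h1.prodMk_nhds (hinv.prodMk_nhds (h2.prodMk_nhds
      (tendsto_const_nhds (x := (0 : ℝ)) (f := cocompact E3))))
    convert! h3 using 2
    · simp [normalize, pointRep_coe]
    · simp [normalize, pointRep_infty]
  | coe x =>
    rw [OnePoint.continuousAt_coe]
    have : Continuous fun x : E3 => normalize (pointRep (x : E3hat)) := by
      simp only [normalize, pointRep_coe]
      have h1 : Continuous fun x : E3 => ((1 : ℝ) + ‖x‖ ^ 2) := by fun_prop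
      have h2 : Continuous fun x : E3 => ((x, 1, ‖x‖ ^ 2, 0) : LieVec) := by fun_prop
      refine Continuous.smul (h1.inv₀ fun y => ?_) h2
      positivity
    exact this.continuousAt

lemma isEmbedding_normalize_pointRep :
    IsEmbedding fun p : E3hat => normalize (pointRep p) :=
  (continuous_normalize_pointRep.isClosedEmbedding normalize_pointRep_injective).isEmbedding

lemma exists_smul_of_mem_span {p : E3hat} {V : LieVec} (h : pointRep p ∈ Submodule.span ℝ {V}) :
    ∃ c : ℝ, c ≠ 0 ∧ V = c • pointRep p := by
  obtain ⟨c, hc⟩ := Submodule.mem_span_singleton.mp h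
  have hc0 : c ≠ 0 := by
    rintro rfl
    rw [zero_smul] at hc
    exact pointRep_ne_zero p hc.symm
  exact ⟨c⁻¹, inv_ne_zero hc0, by rw [← hc, smul_smul, inv_mul_cancel₀ hc0, one_smul]⟩

/-- A map into `ℝ³ ∪ {∞}` is continuous if it is in homogeneous coordinates. -/
lemma continuous_of_lift {α : Type*} [TopologicalSpace α] {γ : α → E3hat} {G : α → LieVec}
    (hG : Continuous G) (h : ∀ s, pointRep (γ s) ∈ Submodule.span ℝ {G s}) : Continuous γ := by
  rw [isEmbedding_normalize_pointRep.continuous_iff]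
  have : (fun p : E3hat => normalize (pointRep p)) ∘ γ = fun s => normalize (G s) := by
    funext s
    obtain ⟨c, hc, e⟩ := exists_smul_of_mem_span (h s)
    simp only [Function.comp, e, normalize_smul hc]
  rw [this]
  unfold normalize
  have h1 : Continuous fun s => (G s).2.1 + (G s).2.2.1 := by fun_prop
  refine Continuous.smul (h1.inv₀ fun s => ?_) hG
  obtain ⟨c, hc, e⟩ := exists_smul_of_mem_span (h s)
  rw [e]
  simp only [Prod.smul_snd, Prod.smul_fst, smul_eq_mul, ← mul_add]
  exact mul_ne_zero hc (pointRep_weight_ne_zero _)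

/-! ## Initial tangents -/

instance neBot_nhdsGT_zero : (𝓝[>] (0 : unitInterval)).NeBot :=
  nhdsGT_neBot_of_exists_gt ⟨1, zero_lt_one⟩

lemma IsInitialTangent.unique {γ : unitInterval → E3hat} {t t' : E3} (h : IsInitialTangent γ t)
    (h' : IsInitialTangent γ t') : t = t' := by
  obtain ⟨x, hx, -, -, hlim⟩ := h
  obtain ⟨x', hx', -, -, hlim'⟩ := h'
  obtain rfl : x = x' := OnePoint.coe_injective (hx.symm.trans hx')
  exact tendsto_nhds_unique hlim hlim'

/-- The initial tangent of an arc depends on the arc only. -/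
lemma IsInitialTangent.of_range_eq {γ δ : unitInterval → E3hat} (hγ : Continuous γ)
    (hγi : Function.Injective γ) (hδ : Continuous δ) (hδi : Function.Injective δ)
    (h0 : γ 0 = δ 0) (hr : Set.range γ = Set.range δ) {t : E3} (ht : IsInitialTangent γ t) :
    IsInitialTangent δ t := by
  obtain ⟨x, hx, -, hnorm, hlim⟩ := ht
  refine ⟨x, h0 ▸ hx, hδ.continuousAt, hnorm, ?_⟩
  have hex : ∀ s, ∃ r, γ r = δ s := fun s => by
    have : δ s ∈ Set.range γ := hr ▸ Set.mem_range_self s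
    exact this
  -- The reparametrization `γ⁻¹ ∘ δ`. It is continuous because `γ` is an embedding, and by
  -- injectivity it tends to 0 from the right, so the limit of directions is unchanged.
  choose φ hφ using hex
  have hφc : Continuous φ := by
    rw [(hγ.isClosedEmbedding hγi).isEmbedding.continuous_iff]
    convert! hδ using 1
    funext s
    exact hφ s
  have hφ0 : φ 0 = 0 := hγi ((hφ 0).trans h0.symm)
  have hφpos : ∀ s, 0 < s → 0 < φ s := by
    intro s hs
    rw [unitInterval.pos_iff_ne_zero]
    intro h
    have : δ s = δ 0 := by rw [← hφ s, h, h0]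
    exact hs.ne' (hδi this)
  have hφt : Tendsto φ (𝓝[>] 0) (𝓝[>] 0) := by
    refine tendsto_nhdsWithin_iff.mpr ⟨?_, ?_⟩
    · have := hφc.tendsto 0
      rw [hφ0] at this
      exact this.mono_left nhdsWithin_le_nhds
    · filter_upwards [self_mem_nhdsWithin] with s hs using hφpos s hs
  refine (hlim.comp hφt).congr fun s => ?_
  simp only [Function.comp, hφ s]

lemma finitePart_of_mem_span {p : E3hat} {V : LieVec} (h : pointRep p ∈ Submodule.span ℝ {V})
    (hw : V.2.1 ≠ 0) : finitePart p = V.2.1⁻¹ • V.1 := by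
  obtain ⟨c, hc, rfl⟩ := exists_smul_of_mem_span h
  induction p using OnePoint.rec with
  | infty => simp [pointRep_infty] at hw
  | coe x =>
    simp only [pointRep_coe, Prod.smul_mk, smul_eq_mul, mul_one, smul_smul, inv_mul_cancel₀ hc,
      one_smul]
    rfl

/-- The tangent vector at `x` of a curve of points with velocity `W` in homogeneous coordinates. -/
def tangentVec (x : E3) (W : LieVec) : E3 := W.1 - W.2.1 • x

/-- Orthogonality to the representative of `x` determines the `e_∞`-component from the others, and
with it the terms containing `x` cancel. Angles at `x` can thus be computed in Lie geometry. -/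
lemma inner_tangentVec {x : E3} {V W : LieVec} (hV : lieForm (pointRep (x : E3hat)) V = 0)
    (hW : lieForm (pointRep (x : E3hat)) W = 0) (hr : V.2.2.2 = 0) :
    inner ℝ (tangentVec x V) (tangentVec x W) = lieForm V W := by
  simp only [lieForm, pointRep_coe, tangentVec, inner_sub_left, inner_sub_right,
    real_inner_smul_left, real_inner_smul_right, real_inner_self_eq_norm_sq, hr] at *
  rw [real_inner_comm x V.1]
  linear_combination -W.2.1 * hV - V.2.1 * hW

/-- Regular curves in homogeneous coordinates have initial tangents. -/
lemma exists_isInitialTangent {γ : unitInterval → E3hat} {x : E3} {V : ℝ → LieVec} {V' : LieVec}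
    {σ : ℝ} {c : ℝ} {u : unitInterval → ℝ} (hγ : Continuous γ) (h0 : γ 0 = (x : E3hat))
    (hV : HasDerivAt V V' σ) (hVσ : V σ = c • pointRep (x : E3hat)) (hc : c ≠ 0)
    (hx : lieForm (pointRep (x : E3hat)) V' = 0) (hr : V'.2.2.2 = 0) (hn : lieForm V' V' ≠ 0)
    (hlift : ∀ᶠ s in 𝓝[>] 0, pointRep (γ s) ∈ Submodule.span ℝ {V (u s)})
    (hu : Tendsto u (𝓝[>] 0) (𝓝 σ))
    (hside : (∀ᶠ s in 𝓝[>] 0, σ < u s) ∨ ∀ᶠ s in 𝓝[>] 0, u s < σ) :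
    ∃ k : ℝ, k ≠ 0 ∧ IsInitialTangent γ (k • tangentVec x V') := by
  have hD : tangentVec x V' ≠ 0 := by
    intro h
    rw [← inner_tangentVec hx hx hr, h, inner_zero_left] at hn
    exact hn rfl
  have hwσ : (V σ).2.1 = c := by simp [hVσ, pointRep_coe]
  have hvσ : (V σ).1 = c • x := by simp [hVσ, pointRep_coe]
  have hv : HasDerivAt (fun r => (V r).1) V'.1 σ := by
    exact (ContinuousLinearMap.fst ℝ E3 (ℝ × ℝ × ℝ)).hasFDerivAt.comp_hasDerivAt σ hV
  have hw : HasDerivAt (fun r => (V r).2.1) V'.2.1 σ :=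
    ((ContinuousLinearMap.fst ℝ ℝ (ℝ × ℝ)).comp
      (ContinuousLinearMap.snd ℝ E3 (ℝ × ℝ × ℝ))).hasFDerivAt.comp_hasDerivAt σ hV
  -- The Euclidean curve obtained by dehomogenizing; its velocity at `σ` is `c⁻¹ • tangentVec x V'`,
  -- nonzero because `V'` is not isotropic.
  let F : ℝ → E3 := fun r => (V r).2.1⁻¹ • (V r).1
  have hF : HasDerivAt F (c⁻¹ • tangentVec x V') σ := by
    have := (hw.fun_inv (hwσ ▸ hc)).fun_smul hv
    convert! this using 1
    rw [hwσ, hvσ, tangentVec, smul_sub, smul_smul, smul_smul]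
    have : -V'.2.1 / c ^ 2 * c = -(c⁻¹ * V'.2.1) := by
      field_simp
    rw [this, neg_smul, sub_eq_add_neg]
  have hFσ : F σ = x := by
    simp only [F, hwσ, hvσ, smul_smul, inv_mul_cancel₀ hc, one_smul]
  have hF0 : c⁻¹ • tangentVec x V' ≠ 0 := smul_ne_zero (inv_ne_zero hc) hD
  have hslope := (hasDerivAt_iff_tendsto_slope.mp hF)
  have hnormed : Tendsto (fun r => ‖slope F σ r‖⁻¹ • slope F σ r) (𝓝[≠] σ)
      (𝓝 (‖c⁻¹ • tangentVec x V'‖⁻¹ • (c⁻¹ • tangentVec x V'))) :=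
    (hslope.norm.inv₀ (norm_ne_zero_iff.mpr hF0)).smul hslope
  have hfin : ∀ᶠ s in 𝓝[>] 0, finitePart (γ s) = F (u s) := by
    have hne : ∀ᶠ r in 𝓝 σ, (V r).2.1 ≠ 0 := hw.continuousAt.eventually_ne (hwσ ▸ hc)
    filter_upwards [hlift, hu.eventually hne] with s hs hs'
    exact finitePart_of_mem_span hs hs'
  have hsl : ∀ r, r ≠ σ → F r - x = (r - σ) • slope F σ r := by
    intro r hr
    rw [slope_def_module, hFσ, smul_smul, mul_inv_cancel₀ (sub_ne_zero.mpr hr), one_smul]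
  have hnorm1 : ‖(‖c⁻¹ • tangentVec x V'‖⁻¹ • (c⁻¹ • tangentVec x V'))‖ = 1 := by
    rw [norm_smul, norm_inv, norm_norm, inv_mul_cancel₀ (norm_ne_zero_iff.mpr hF0)]
  have hk : ‖c⁻¹ • tangentVec x V'‖⁻¹ * c⁻¹ ≠ 0 :=
    mul_ne_zero (inv_ne_zero (norm_ne_zero_iff.mpr hF0)) (inv_ne_zero hc)
  rw [smul_smul] at hnorm1 hnormed
  rcases hside with hs | hs
  · refine ⟨_, hk, x, h0, hγ.continuousAt, hnorm1, ?_⟩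
    have hut : Tendsto u (𝓝[>] 0) (𝓝[≠] σ) :=
      tendsto_nhdsWithin_iff.mpr ⟨hu, hs.mono fun s h => h.ne'⟩
    refine (hnormed.comp hut).congr' ?_
    filter_upwards [hs, hfin] with s h1 h2
    rw [h2, hsl _ h1.ne', norm_smul, Real.norm_of_nonneg (sub_pos.mpr h1).le, smul_smul]
    simp only [Function.comp]
    have := (sub_pos.mpr h1).ne'
    congr 1
    rw [mul_inv]
    field_simp
  -- A parameter approaching `σ` from below runs through the curve backwards, which reverses the
  -- tangent.
  · refine ⟨-(‖c⁻¹ • tangentVec x V'‖⁻¹ * c⁻¹), neg_ne_zero.mpr hk, x, h0, hγ.continuousAt, ?_, ?_⟩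
    · rw [neg_smul, norm_neg, hnorm1]
    have hut : Tendsto u (𝓝[>] 0) (𝓝[≠] σ) :=
      tendsto_nhdsWithin_iff.mpr ⟨hu, hs.mono fun s h => h.ne⟩
    rw [neg_smul]
    refine (hnormed.comp hut).neg.congr' ?_
    filter_upwards [hs, hfin] with s h1 h2
    rw [h2, hsl _ h1.ne, norm_smul, Real.norm_of_nonpos (sub_neg.mpr h1).le, smul_smul]
    simp only [Function.comp]
    have := (sub_neg.mpr h1).ne
    rw [← neg_smul]
    congr 1
    rw [mul_inv, inv_neg]
    field_simp

/-- An injective continuous parameter stays finite and on one side of a finite initial value. -/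
lemma exists_real_param {u : unitInterval → OnePoint ℝ} (hc : Continuous u)
    (hi : Function.Injective u) {σ : ℝ} (h0 : u 0 = (σ : OnePoint ℝ)) :
    ∃ w : unitInterval → ℝ, (∀ᶠ s in 𝓝[>] 0, u s = (w s : OnePoint ℝ)) ∧
      Tendsto w (𝓝[>] 0) (𝓝 σ) ∧ ((∀ᶠ s in 𝓝[>] 0, σ < w s) ∨ ∀ᶠ s in 𝓝[>] 0, w s < σ) := by
  -- The value 0 at `∞` is a dummy: `u` is finite near the initial parameter.
  let g : OnePoint ℝ → ℝ := fun p => p.elim 0 id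
  have hg : ∀ r : ℝ, ContinuousAt g (r : OnePoint ℝ) := fun r =>
    OnePoint.continuousAt_coe.mpr continuousAt_id
  have hgr : ∀ r : ℝ, g (r : OnePoint ℝ) = r := fun r => rfl
  have hnear : ∀ᶠ s in 𝓝 (0 : unitInterval), u s ≠ OnePoint.infty :=
    hc.continuousAt.eventually_ne (h0 ▸ OnePoint.coe_ne_infty σ)
  have hfin : ∀ s, u s ≠ OnePoint.infty → u s = (g (u s) : OnePoint ℝ) := by
    intro s hs
    obtain ⟨r, hr⟩ := OnePoint.ne_infty_iff_exists.mp hs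
    rw [← hr, hgr]
  have hcont : ∀ s, u s ≠ OnePoint.infty → ContinuousAt (g ∘ u) s := by
    intro s hs
    refine ContinuousAt.comp ?_ hc.continuousAt
    rw [hfin s hs]
    exact hg _
  refine ⟨g ∘ u, ?_, ?_, ?_⟩
  · exact (hnear.filter_mono nhdsWithin_le_nhds).mono hfin
  · have := (hcont 0 (h0 ▸ OnePoint.coe_ne_infty σ)).tendsto
    simp only [Function.comp, h0, hgr] at this
    exact this.mono_left nhdsWithin_le_nhds
  · have hev : {s | u s ≠ OnePoint.infty} ∈ 𝓝[>] (0 : unitInterval) :=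
      hnear.filter_mono nhdsWithin_le_nhds
    rw [mem_nhdsGT_iff_exists_Ioo_subset' zero_lt_one] at hev
    obtain ⟨e, he, hsub⟩ := hev
    have hne : ∀ s ∈ Set.Ioo 0 e, (g ∘ u) s ≠ σ := by
      intro s hs h
      have h1 := hfin s (hsub hs)
      simp only [Function.comp] at h
      rw [h, ← h0] at h1
      exact hs.1.ne' (hi h1)
    have hco : ContinuousOn (g ∘ u) (Set.Ioo 0 e) := fun s hs =>
      (hcont s (hsub hs)).continuousWithinAt
    have hmem : Set.Ioo 0 e ∈ 𝓝[>] (0 : unitInterval) := Ioo_mem_nhdsGT he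
    -- If both sides of `σ` were visited arbitrarily early, the intermediate value theorem would
    -- give a return to `σ`, contrary to injectivity.
    by_contra! hcon
    obtain ⟨h1, h2⟩ := hcon
    obtain ⟨a, ha, haσ⟩ := (h1.and_eventually hmem).exists
    obtain ⟨b, hb, hbσ⟩ := (h2.and_eventually hmem).exists
    obtain ⟨s, hs, hsσ⟩ := isPreconnected_Ioo.intermediate_value haσ hbσ hco ⟨ha, hb⟩
    exact hne s hs hsσ

/-! ## The geometry of a cyclidic patch at a vertex -/

/-- The properties of a patch at the vertex `f 0 0` that determine its role in a cube. -/
structure HasCornerGeometry (f : Patch) : Prop where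
  continuous_left : Continuous fun s => f s 0
  injective_left : Function.Injective fun s => f s 0
  continuous_right : Continuous fun t => f 0 t
  injective_right : Function.Injective fun t => f 0 t
  tangents : ∀ x : E3, f 0 0 = (x : E3hat) → ∃ t₁ t₂ : E3,
    IsInitialTangent (fun s => f s 0) t₁ ∧ IsInitialTangent (fun t => f 0 t) t₂ ∧ inner ℝ t₁ t₂ = 0
  planar : pointRep (f 1 1) ∈ circleSpan (f 0 0) (f 1 0) (f 0 1)

lemma HasCornerGeometry.swap {f : Patch} (h : HasCornerGeometry fun s t => f t s) :
    HasCornerGeometry f where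
  continuous_left := h.continuous_right
  injective_left := h.injective_right
  continuous_right := h.continuous_left
  injective_right := h.injective_left
  tangents := fun x hx => by
    obtain ⟨t₁, t₂, h₁, h₂, h₁₂⟩ := h.tangents x hx
    exact ⟨t₂, t₁, h₂, h₁, by rwa [real_inner_comm]⟩
  planar := by
    refine circleSpan_le ?_ ?_ ?_ h.planar
    exacts [left_mem_circleSpan _ _ _, right_mem_circleSpan _ _ _, middle_mem_circleSpan _ _ _]

lemma HasNonsingularVertices.swap {f : Patch} (h : HasNonsingularVertices f) :
    HasNonsingularVertices fun s t => f t s :=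
  ⟨h.2.2.1, h.2.2.2, h.1, h.2.1⟩

/-- For a translation surface `A + B`, the corner `A₁ + B₁` is `(A₁ + B₀) + (A₀ + B₁) - (A₀ + B₀)`.
This is why the four vertices of a patch are concircular. -/
lemma mem_circleSpan_of_add {p q r z : E3hat} {P Q R Z : LieVec}
    (hp : pointRep p ∈ Submodule.span ℝ {P}) (hq : pointRep q ∈ Submodule.span ℝ {Q})
    (hr : pointRep r ∈ Submodule.span ℝ {R}) (hz : pointRep z ∈ Submodule.span ℝ {Z})
    (h : Z = Q + R - P) : pointRep z ∈ circleSpan p q r := by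
  obtain ⟨a, -, rfl⟩ := exists_smul_of_mem_span hp
  obtain ⟨b, -, rfl⟩ := exists_smul_of_mem_span hq
  obtain ⟨c, -, rfl⟩ := exists_smul_of_mem_span hr
  obtain ⟨d, hd, rfl⟩ := exists_smul_of_mem_span hz
  rw [← Submodule.smul_mem_iff _ hd, h]
  exact Submodule.sub_mem _ (Submodule.add_mem _
    (Submodule.smul_mem _ _ (middle_mem_circleSpan _ _ _))
    (Submodule.smul_mem _ _ (right_mem_circleSpan _ _ _)))
    (Submodule.smul_mem _ _ (left_mem_circleSpan _ _ _))

lemma lieForm_eR (V : LieVec) : lieForm V eR = -V.2.2.2 := by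
  simp [lieForm, eR]

lemma r_of_preserves {T : LieVec ≃ₗ[ℝ] LieVec} (hT : ∀ u w, lieForm (T u) (T w) = lieForm u w)
    (hTe : T eR = eR) (V : LieVec) : (T V).2.2.2 = V.2.2.2 := by
  have := hT V eR
  rw [hTe, lieForm_eR, lieForm_eR] at this
  linarith

/-- A patch that is locally a translation surface in homogeneous coordinates has orthogonal initial
tangents. -/
lemma exists_orthogonal_tangents {f : Patch} {x : E3} {T : LieVec ≃ₗ[ℝ] LieVec}
    (hT : ∀ u w, lieForm (T u) (T w) = lieForm u w) (hTe : T eR = eR) {A B : ℝ → LieVec}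
    {A' B' : LieVec} {σ τ : ℝ} {u v : unitInterval → ℝ}
    (hcl : Continuous fun s => f s 0) (hcr : Continuous fun t => f 0 t) (h0 : f 0 0 = (x : E3hat))
    (hA : HasDerivAt A A' σ) (hB : HasDerivAt B B' τ)
    (hx : pointRep (f 0 0) ∈ Submodule.span ℝ {T (A σ + B τ)})
    (hxA : lieForm (A σ + B τ) A' = 0) (hxB : lieForm (A σ + B τ) B' = 0)
    (hrA : A'.2.2.2 = 0) (hrB : B'.2.2.2 = 0) (hnA : lieForm A' A' ≠ 0) (hnB : lieForm B' B' ≠ 0)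
    (hAB : lieForm A' B' = 0)
    (hl : ∀ᶠ s in 𝓝[>] 0, pointRep (f s 0) ∈ Submodule.span ℝ {T (A (u s) + B τ)})
    (hr : ∀ᶠ t in 𝓝[>] 0, pointRep (f 0 t) ∈ Submodule.span ℝ {T (A σ + B (v t))})
    (hu : Tendsto u (𝓝[>] 0) (𝓝 σ))
    (hus : (∀ᶠ s in 𝓝[>] 0, σ < u s) ∨ ∀ᶠ s in 𝓝[>] 0, u s < σ)
    (hv : Tendsto v (𝓝[>] 0) (𝓝 τ))
    (hvs : (∀ᶠ s in 𝓝[>] 0, τ < v s) ∨ ∀ᶠ s in 𝓝[>] 0, v s < τ) :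
    ∃ t₁ t₂ : E3, IsInitialTangent (fun s => f s 0) t₁ ∧ IsInitialTangent (fun t => f 0 t) t₂ ∧
      inner ℝ t₁ t₂ = 0 := by
  let L : LieVec →L[ℝ] LieVec := LinearMap.toContinuousLinearMap (T : LieVec →ₗ[ℝ] LieVec)
  have hL : ∀ V, L V = T V := fun V => rfl
  rw [h0] at hx
  obtain ⟨c, hc, hcx⟩ := exists_smul_of_mem_span hx
  have hform : ∀ W, lieForm (A σ + B τ) W = 0 → lieForm (pointRep (x : E3hat)) (T W) = 0 := by
    intro W hW
    rw [← hT, hcx, lieForm_smul_left] at hW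
    exact (mul_eq_zero.mp hW).resolve_left hc
  have hVA : HasDerivAt (fun r => T (A r + B τ)) (T A') σ :=
    L.hasFDerivAt.comp_hasDerivAt σ (hA.add_const (B τ))
  have hVB : HasDerivAt (fun r => T (A σ + B r)) (T B') τ :=
    L.hasFDerivAt.comp_hasDerivAt τ (hB.const_add (A σ))
  have hrA' : (T A').2.2.2 = 0 := by rw [r_of_preserves hT hTe, hrA]
  have hrB' : (T B').2.2.2 = 0 := by rw [r_of_preserves hT hTe, hrB]
  obtain ⟨k, -, hk⟩ := exists_isInitialTangent hcl h0 hVA hcx hc (hform _ hxA) hrA'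
    (by rwa [hT]) hl hu hus
  obtain ⟨l, -, hl⟩ := exists_isInitialTangent hcr h0 hVB hcx hc (hform _ hxB) hrB'
    (by rwa [hT]) hr hv hvs
  refine ⟨_, _, hk, hl, ?_⟩
  rw [real_inner_smul_left, real_inner_smul_right,
    inner_tangentVec (hform _ hxA) (hform _ hxB) hrA', hT, hAB, mul_zero, mul_zero]

/-! ### Patches of Dupin cyclides -/

/-- Parametrized conics in polar planes. -/
structure IsConjugatePair (a b : ℝ → LieVec) (a' b' : LieVec) : Prop where
  continuous_a : Continuous a
  continuous_b : Continuous b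
  deriv_a : HasDerivAt a a' 0
  deriv_b : HasDerivAt b b' 0
  form_a : ∃ c : ℝ, c ≠ 0 ∧ ∀ s s', lieForm (a s) (a s') = c * (s - s') ^ 2
  form_b : ∃ c : ℝ, c ≠ 0 ∧ ∀ s s', lieForm (b s) (b s') = c * (s - s') ^ 2
  aa' : lieForm (a 0) a' = 0
  bb' : lieForm (b 0) b' = 0
  a'a' : lieForm a' a' ≠ 0
  b'b' : lieForm b' b' ≠ 0
  ab : ∀ s t, lieForm (a s) (b t) = 0
  a'b : ∀ t, lieForm a' (b t) = 0
  ab' : ∀ s, lieForm (a s) b' = 0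
  a'b' : lieForm a' b' = 0

namespace IsConjugatePair

variable {a b : ℝ → LieVec} {a' b' : LieVec} {f : Patch}

lemma swap (h : IsConjugatePair a b a' b') : IsConjugatePair b a b' a' where
  continuous_a := h.continuous_b
  continuous_b := h.continuous_a
  deriv_a := h.deriv_b
  deriv_b := h.deriv_a
  form_a := h.form_b
  form_b := h.form_a
  aa' := h.bb'
  bb' := h.aa'
  a'a' := h.b'b'
  b'b' := h.a'a'
  ab := fun s t => by rw [lieForm_comm, h.ab]
  a'b := fun s => by rw [lieForm_comm, h.ab']
  ab' := fun s => by rw [lieForm_comm, h.a'b]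
  a'b' := by rw [lieForm_comm, h.a'b']

lemma self (h : IsConjugatePair a b a' b') (s : ℝ) : lieForm (a s) (a s) = 0 := by
  obtain ⟨c, -, hc⟩ := h.form_a
  rw [hc]
  ring

/-- A multiple of `b t` is orthogonal to the whole first conic, whereas `a s` is not orthogonal to
`a (s + 1)`. -/
lemma ne_smul (h : IsConjugatePair a b a' b') (s t k : ℝ) : a s ≠ k • b t := by
  intro he
  obtain ⟨c, hc0, hc⟩ := h.form_a
  have h1 := hc s (s + 1)
  rw [he, lieForm_smul_left, lieForm_comm, h.ab, mul_zero] at h1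
  exact hc0 (by linarith [h1])

lemma ne_zero (h : IsConjugatePair a b a' b') (s : ℝ) : a s ≠ 0 := by
  have := h.ne_smul s 0 0
  rwa [zero_smul] at this

/-- The two spheres of a contact element are not both points. -/
lemma r_ne_zero_or (h : IsConjugatePair a b a' b') (s t : ℝ) :
    (a s).2.2.2 ≠ 0 ∨ (b t).2.2.2 ≠ 0 := by
  by_contra! hr
  obtain ⟨p, c, hc, hp⟩ := exists_pointRep (h.ne_zero s) hr.1 (h.self s)
  obtain ⟨q, d, hd, hq⟩ := exists_pointRep (h.swap.ne_zero t) hr.2 (h.swap.self t)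
  have hab := h.ab s t
  rw [hp, hq, lieForm_smul_left, lieForm_smul_right] at hab
  have hpq : p = q := (lieForm_pointRep_eq_zero_iff p q).mp
    ((mul_eq_zero.mp ((mul_eq_zero.mp hab).resolve_left hc)).resolve_left hd)
  refine h.ne_smul s t (c * d⁻¹) ?_
  rw [hp, hq, hpq, smul_smul, mul_assoc, inv_mul_cancel₀ hd, mul_one]

lemma exists_comb (hf : ∀ s t : unitInterval,
      pointRep (f s t) ∈ Submodule.span ℝ {a s, b t}) (s t : unitInterval) :
    ∃ α β : ℝ, pointRep (f s t) = α • a s + β • b t ∧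
      α * (a s).2.2.2 + β * (b t).2.2.2 = 0 := by
  obtain ⟨α, β, h⟩ := Submodule.mem_span_pair.mp (hf s t)
  refine ⟨α, β, h.symm, ?_⟩
  have := pointRep_r (f s t)
  rw [← h] at this
  simpa using this

/-- A point sphere of the second family is a singular point. -/
lemma eq_of_r_eq_zero (h : IsConjugatePair a b a' b') (hf : ∀ s t : unitInterval,
      pointRep (f s t) ∈ Submodule.span ℝ {a s, b t}) {t : unitInterval}
    (ht : (b t).2.2.2 = 0) (s s' : unitInterval) : f s t = f s' t := by
  have key : ∀ s, ∃ β : ℝ, pointRep (f s t) = β • b t := by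
    intro s
    obtain ⟨α, β, h1, h2⟩ := exists_comb hf s t
    rw [ht, mul_zero, add_zero] at h2
    have hα : α = 0 := (mul_eq_zero.mp h2).resolve_right
      ((h.r_ne_zero_or s t).resolve_right (not_not.mpr ht))
    exact ⟨β, by rw [h1, hα, zero_smul, zero_add]⟩
  obtain ⟨β, hβ⟩ := key s
  obtain ⟨γ, hγ⟩ := key s'
  have hγ0 : γ ≠ 0 := by
    rintro rfl
    exact pointRep_ne_zero _ (hγ.trans (zero_smul _ _))
  refine eq_of_pointRep_eq_smul (c := β * γ⁻¹) ?_
  rw [hβ, hγ, smul_smul, mul_assoc, inv_mul_cancel₀ hγ0, mul_one]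

/-- The point sphere of the contact element is found by eliminating the `e_r`-component. Only that
of `b t` must be nonzero, so the formula holds along the whole parameter line, even where `a s` is a
point sphere. -/
lemma mem_span_left (hf : ∀ s t : unitInterval,
      pointRep (f s t) ∈ Submodule.span ℝ {a s, b t}) {t : unitInterval}
    (ht : (b t).2.2.2 ≠ 0) (s : unitInterval) :
    pointRep (f s t) ∈ Submodule.span ℝ {(b t).2.2.2 • a s - (a s).2.2.2 • b t} := by
  obtain ⟨α, β, h1, h2⟩ := exists_comb hf s t
  refine Submodule.mem_span_singleton.mpr ⟨α / (b t).2.2.2, ?_⟩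
  have hβ : β = -(α / (b t).2.2.2 * (a s).2.2.2) := by
    field_simp
    linarith
  rw [h1, hβ, smul_sub, smul_smul, smul_smul, div_mul_cancel₀ _ ht, neg_smul, sub_eq_add_neg]

lemma continuous_left (h : IsConjugatePair a b a' b') (hf : ∀ s t : unitInterval,
      pointRep (f s t) ∈ Submodule.span ℝ {a s, b t}) {t : unitInterval}
    (ht : (b t).2.2.2 ≠ 0) : Continuous fun s => f s t := by
  refine continuous_of_lift ?_ (mem_span_left hf ht)
  have := h.continuous_a
  fun_prop

/-- Since the two conics are orthogonal and isotropic, the form between the points at `s` and `s'`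
is a nonzero multiple of `(s - s')²`. -/
lemma injective_left (h : IsConjugatePair a b a' b') (hf : ∀ s t : unitInterval,
      pointRep (f s t) ∈ Submodule.span ℝ {a s, b t}) {t : unitInterval}
    (ht : (b t).2.2.2 ≠ 0) : Function.Injective fun s => f s t := by
  intro s s' hss
  simp only at hss
  obtain ⟨k, -, hk⟩ := exists_smul_of_mem_span (mem_span_left hf ht s)
  obtain ⟨l, -, hl⟩ := exists_smul_of_mem_span (mem_span_left hf ht s')
  have h1 : lieForm ((b t).2.2.2 • a s - (a s).2.2.2 • b t)
      ((b t).2.2.2 • a s' - (a s').2.2.2 • b t) = 0 := by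
    rw [hk, hl, hss, lieForm_smul_left, lieForm_smul_right, lieForm_pointRep_self, mul_zero,
      mul_zero]
  obtain ⟨c, hc0, hc⟩ := h.form_a
  simp only [lieForm_sub_left, lieForm_sub_right, lieForm_smul_left, lieForm_smul_right, h.ab,
    h.swap.ab, h.swap.self, hc] at h1
  have h2 : ((b t).2.2.2) ^ 2 * c * ((s : ℝ) - s') ^ 2 = 0 := by linarith
  simp only [mul_eq_zero, pow_eq_zero_iff two_ne_zero, ht, hc0, false_or, sub_eq_zero] at h2
  exact Subtype.ext h2

/-- Scaling both spheres to `e_r`-component 1 makes the point their difference, so that the patch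
becomes a translation surface in homogeneous coordinates. -/
lemma mem_span_add (hf : ∀ s t : unitInterval,
      pointRep (f s t) ∈ Submodule.span ℝ {a s, b t}) {s t : unitInterval}
    (hs : (a s).2.2.2 ≠ 0) (ht : (b t).2.2.2 ≠ 0) :
    pointRep (f s t) ∈ Submodule.span ℝ
      {(a s).2.2.2⁻¹ • a s + -((b t).2.2.2⁻¹ • b t)} := by
  obtain ⟨α, β, h1, h2⟩ := exists_comb hf s t
  refine Submodule.mem_span_singleton.mpr ⟨α * (a s).2.2.2, ?_⟩
  have hβ : β = -(α * (a s).2.2.2 * (b t).2.2.2⁻¹) := by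
    field_simp
    linarith
  rw [h1, hβ, smul_add, smul_neg, smul_smul, smul_smul, mul_assoc α, mul_inv_cancel₀ hs, mul_one,
    neg_smul]

lemma hasDerivAt_normalized (h : IsConjugatePair a b a' b') (h0 : (a 0).2.2.2 ≠ 0) :
    HasDerivAt (fun s => (a s).2.2.2⁻¹ • a s)
      ((a 0).2.2.2⁻¹ • a' + (-a'.2.2.2 / (a 0).2.2.2 ^ 2) • a 0) 0 := by
  have hr : HasDerivAt (fun s => (a s).2.2.2) a'.2.2.2 0 :=
    ((ContinuousLinearMap.snd ℝ ℝ ℝ).comp ((ContinuousLinearMap.snd ℝ ℝ (ℝ × ℝ)).comp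
      (ContinuousLinearMap.snd ℝ E3 (ℝ × ℝ × ℝ)))).hasFDerivAt.comp_hasDerivAt 0 h.deriv_a
  exact (hr.fun_inv h0).fun_smul h.deriv_a

lemma hasCornerGeometry (h : IsConjugatePair a b a' b') (hf : ∀ s t : unitInterval,
      pointRep (f s t) ∈ Submodule.span ℝ {a s, b t}) (hns : HasNonsingularVertices f) :
    HasCornerGeometry f := by
  obtain ⟨⟨s₀, h₁⟩, ⟨s₁, h₂⟩, ⟨t₀, h₃⟩, ⟨t₁, h₄⟩⟩ := hns
  have hf' : ∀ t s : unitInterval, pointRep (f s t) ∈ Submodule.span ℝ {b t, a s} := fun t s => by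
    rw [Set.pair_comm]
    exact hf s t
  have hb0 : (b (0 : unitInterval)).2.2.2 ≠ 0 := fun h' => h₁ (h.eq_of_r_eq_zero hf h' _ _)
  -- As at the other three parameter values, a point sphere would collapse the parameter line to its
  -- single point, contrary to nonsingularity of the vertices on it.
  have hb1 : (b (1 : unitInterval)).2.2.2 ≠ 0 := fun h' => h₂ (h.eq_of_r_eq_zero hf h' _ _)
  have ha0 : (a (0 : unitInterval)).2.2.2 ≠ 0 := fun h' =>
    h₃ (h.swap.eq_of_r_eq_zero (f := fun t s => f s t) hf' h' _ _)
  have ha1 : (a (1 : unitInterval)).2.2.2 ≠ 0 := fun h' =>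
    h₄ (h.swap.eq_of_r_eq_zero (f := fun t s => f s t) hf' h' _ _)
  have hcl := h.continuous_left hf hb0
  have hcr := h.swap.continuous_left (f := fun t s => f s t) hf' ha0
  refine ⟨hcl, h.injective_left hf hb0, hcr,
    h.swap.injective_left (f := fun t s => f s t) hf' ha0, fun x hx => ?_, ?_⟩
  · have hu : Tendsto (fun s : unitInterval => (s : ℝ)) (𝓝[>] 0) (𝓝 0) :=
      (continuous_subtype_val.tendsto (0 : unitInterval)).mono_left nhdsWithin_le_nhds
    have hus : ∀ᶠ s : unitInterval in 𝓝[>] 0, (0 : ℝ) < s := by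
      filter_upwards [self_mem_nhdsWithin] with s hs using hs
    have hev : ∀ {d : ℝ → LieVec}, Continuous d → (d (0 : unitInterval)).2.2.2 ≠ 0 →
        ∀ᶠ s : unitInterval in 𝓝[>] 0, (d s).2.2.2 ≠ 0 := by
      intro d hd hd0
      have : Continuous fun s : unitInterval => (d s).2.2.2 := by fun_prop
      exact (this.continuousAt.eventually_ne hd0).filter_mono nhdsWithin_le_nhds
    have hl : ∀ᶠ s : unitInterval in 𝓝[>] 0, pointRep (f s 0) ∈ Submodule.span ℝ
        {(a s).2.2.2⁻¹ • a s + -((b 0).2.2.2⁻¹ • b 0)} := by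
      filter_upwards [hev h.continuous_a ha0] with s hs
      have := mem_span_add hf hs hb0
      rwa [Set.Icc.coe_zero] at this
    have hr : ∀ᶠ t : unitInterval in 𝓝[>] 0, pointRep (f 0 t) ∈ Submodule.span ℝ
        {(a 0).2.2.2⁻¹ • a 0 + -((b t).2.2.2⁻¹ • b t)} := by
      filter_upwards [hev h.continuous_b hb0] with t ht
      have := mem_span_add hf ha0 ht
      rwa [Set.Icc.coe_zero] at this
    have hx' := mem_span_add hf ha0 hb0
    rw [Set.Icc.coe_zero] at ha0 hb0 hx'
    -- The normalized `e_r`-component is constant, so both derivatives have none; they are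
    -- orthogonal to each other because the planes are polar.
    have hA := h.hasDerivAt_normalized ha0
    have hB := (h.swap.hasDerivAt_normalized hb0).fun_neg
    refine exists_orthogonal_tangents (T := LinearEquiv.refl ℝ LieVec) (fun _ _ => rfl) rfl
      (A := fun s => (a s).2.2.2⁻¹ • a s) (B := fun t => -((b t).2.2.2⁻¹ • b t))
      (u := fun s => s) (v := fun s => s) hcl hcr hx hA hB
      (by simpa only [LinearEquiv.refl_apply] using hx') ?_ ?_ ?_ ?_ ?_ ?_ ?_
      (by simpa only [LinearEquiv.refl_apply] using hl)
      (by simpa only [LinearEquiv.refl_apply] using hr) hu (Or.inl hus) hu (Or.inl hus)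
    · simp [lieForm_add_left, lieForm_add_right, lieForm_smul_left, lieForm_smul_right,
        lieForm_neg_left, h.aa', h.self, h.swap.ab, h.swap.ab']
    · simp [lieForm_add_left, lieForm_add_right, lieForm_smul_left, lieForm_smul_right,
        lieForm_neg_left, lieForm_neg_right, h.bb', h.swap.self, h.ab, h.ab']
    · simp
      field_simp
      ring
    · simp
      field_simp
      ring
    · simp [lieForm_add_left, lieForm_add_right, lieForm_smul_left, lieForm_smul_right, h.aa',
        lieForm_comm a' (a 0), h.self, h.a'a', ha0]
    · simp [lieForm_add_left, lieForm_add_right, lieForm_smul_left, lieForm_smul_right, h.bb',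
        lieForm_neg_left, lieForm_neg_right, lieForm_comm b' (b 0), h.swap.self, h.b'b', hb0]
    · simp [lieForm_add_left, lieForm_add_right, lieForm_smul_left, lieForm_smul_right,
        lieForm_neg_right, h.ab, h.ab', h.a'b, h.a'b']
  · refine mem_circleSpan_of_add (mem_span_add hf ha0 hb0) (mem_span_add hf ha1 hb0)
      (mem_span_add hf ha0 hb1) (mem_span_add hf ha1 hb1) ?_
    abel

end IsConjugatePair

/-- Distinct spheres of one family of a cyclide are not in oriented contact. -/
lemma IsCyclidicPlane.lieForm_ne_zero {P : Submodule ℝ LieVec} (hP : IsCyclidicPlane P)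
    {a b : LieVec} (ha : a ∈ P) (hb : b ∈ P) (haa : lieForm a a = 0) (hbb : lieForm b b = 0)
    (hab : LinearIndependent ℝ ![a, b]) : lieForm a b ≠ 0 := by
  obtain ⟨u, v, w, rfl, huu, hvv, hww, huv, huw, hvw⟩ := hP
  obtain ⟨x, y, z, rfl⟩ := Submodule.mem_span_triple.mp ha
  obtain ⟨x', y', z', rfl⟩ := Submodule.mem_span_triple.mp hb
  have hform : ∀ x y z x' y' z' : ℝ, lieForm (x • u + y • v + z • w) (x' • u + y' • v + z' • w) =
      x * x' + y * y' - z * z' := by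
    intro x y z x' y' z'
    simp only [lieForm_add_left, lieForm_add_right, lieForm_smul_left, lieForm_smul_right, huu, hvv,
      hww, huv, huw, hvw, lieForm_comm v u, lieForm_comm w u, lieForm_comm w v]
    ring
  rw [hform] at haa hbb ⊢
  intro h
  -- The equality case of the Cauchy–Schwarz inequality on the light cone: orthogonal isotropic
  -- vectors of signature `(++-)` are proportional.
  have hsq : (x * z' - x' * z) ^ 2 + (y * z' - y' * z) ^ 2 = 0 := by
    linear_combination z' ^ 2 * haa + z ^ 2 * hbb - 2 * z * z' * h
  have h1 : x * z' - x' * z = 0 := by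
    have := sq_nonneg (x * z' - x' * z)
    have := sq_nonneg (y * z' - y' * z)
    exact pow_eq_zero_iff two_ne_zero |>.mp (by linarith)
  have h2 : y * z' - y' * z = 0 := by
    rw [h1] at hsq
    exact pow_eq_zero_iff two_ne_zero |>.mp (by linarith)
  rw [LinearIndependent.pair_iff] at hab
  obtain ⟨hz', hz⟩ := hab z' (-z) (by
    linear_combination (norm := module) h1 • u + h2 • v)
  have hz0 : z = 0 := neg_eq_zero.mp hz
  subst hz0
  have hx : x = 0 := by nlinarith [sq_nonneg x, sq_nonneg y]
  have hy : y = 0 := by nlinarith [sq_nonneg x, sq_nonneg y]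
  subst hx hy
  exact one_ne_zero (hab 1 0 (by simp)).1

/-- The initial velocity of `conicParam`. -/
def conicDeriv (a : Fin 3 → LieVec) : LieVec :=
  (-3 * lieForm (a 1) (a 2)) • a 0 + lieForm (a 0) (a 2) • a 1 + (-lieForm (a 0) (a 1)) • a 2

lemma hasDerivAt_conicParam (a : Fin 3 → LieVec) : HasDerivAt (conicParam a) (conicDeriv a) 0 := by
  have h1 : HasDerivAt (fun t : ℝ => 2 * t ^ 2 - 3 * t + 1) (-3) 0 := by
    have := (((hasDerivAt_id' (0 : ℝ)).fun_pow 2).const_mul 2).fun_sub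
      ((hasDerivAt_id' (0 : ℝ)).const_mul 3)
    simpa using this.add_const 1
  have h2 : HasDerivAt (fun t : ℝ => t - t ^ 2) 1 0 := by
    simpa using (hasDerivAt_id' (0 : ℝ)).fun_sub ((hasDerivAt_id' (0 : ℝ)).fun_pow 2)
  have h3 : HasDerivAt (fun t : ℝ => 2 * t ^ 2 - t) (-1) 0 := by
    simpa using (((hasDerivAt_id' (0 : ℝ)).fun_pow 2).const_mul 2).fun_sub (hasDerivAt_id' (0 : ℝ))
  have := (((h1.const_mul (lieForm (a 1) (a 2))).smul_const (a 0)).add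
    ((h2.const_mul (lieForm (a 0) (a 2))).smul_const (a 1))).add
    ((h3.const_mul (lieForm (a 0) (a 1))).smul_const (a 2))
  convert! this using 1
  rw [conicDeriv]
  module

lemma continuous_conicParam (a : Fin 3 → LieVec) : Continuous (conicParam a) := by
  unfold conicParam
  fun_prop

/-- The weights of `conicParam` are chosen so that the form depends on the parameter difference
alone. The case `s = s'` shows that the curve stays on the Lie quadric. -/
lemma lieForm_conicParam {a : Fin 3 → LieVec} (h : ∀ i, lieForm (a i) (a i) = 0)
    (s s' : ℝ) : lieForm (conicParam a s) (conicParam a s') =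
    lieForm (a 0) (a 1) * lieForm (a 0) (a 2) * lieForm (a 1) (a 2) * (s - s') ^ 2 := by
  simp only [conicParam, lieForm_add_left, lieForm_add_right, lieForm_smul_left,
    lieForm_smul_right, h, lieForm_comm (a 1) (a 0), lieForm_comm (a 2) (a 0),
    lieForm_comm (a 2) (a 1)]
  ring

lemma lieForm_conicParam_conicDeriv {a : Fin 3 → LieVec} (h : ∀ i, lieForm (a i) (a i) = 0) :
    lieForm (conicParam a 0) (conicDeriv a) = 0 := by
  simp only [conicParam, conicDeriv, lieForm_add_left, lieForm_add_right, lieForm_smul_left,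
    lieForm_smul_right, h, lieForm_comm (a 1) (a 0), lieForm_comm (a 2) (a 0),
    lieForm_comm (a 2) (a 1)]
  ring

lemma lieForm_conicDeriv {a : Fin 3 → LieVec} (h : ∀ i, lieForm (a i) (a i) = 0) :
    lieForm (conicDeriv a) (conicDeriv a) =
    -2 * (lieForm (a 0) (a 1) * lieForm (a 0) (a 2) * lieForm (a 1) (a 2)) := by
  simp only [conicDeriv, lieForm_add_left, lieForm_add_right, lieForm_smul_left,
    lieForm_smul_right, h, lieForm_comm (a 1) (a 0), lieForm_comm (a 2) (a 0),
    lieForm_comm (a 2) (a 1)]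
  ring

lemma IsDupinPatch.hasCornerGeometry {f : Patch} (hf : IsDupinPatch f)
    (hns : HasNonsingularVertices f) : HasCornerGeometry f := by
  obtain ⟨P, Q, hPQ, a, b, ha, hb, hf⟩ := hf
  have hprod : ∀ {R : Submodule ℝ LieVec} {d : Fin 3 → LieVec}, IsCyclidicPlane R →
      AreSpheresOf R d →
      lieForm (d 0) (d 1) * lieForm (d 0) (d 2) * lieForm (d 1) (d 2) ≠ 0 := by
    intro R d hR hd
    have key : ∀ i j, i ≠ j → lieForm (d i) (d j) ≠ 0 := fun i j hij =>
      hR.lieForm_ne_zero (hd.1 i).1 (hd.1 j).1 (hd.1 i).2.2 (hd.1 j).2.2 (hd.2 i j hij)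
    exact mul_ne_zero (mul_ne_zero (key _ _ (by decide)) (key _ _ (by decide)))
      (key _ _ (by decide))
  have hmem : ∀ {R : Submodule ℝ LieVec} {d : Fin 3 → LieVec}, AreSpheresOf R d →
      (∀ s, conicParam d s ∈ R) ∧ conicDeriv d ∈ R := by
    intro R d hd
    have h0 := (hd.1 0).1
    have h1 := (hd.1 1).1
    have h2 := (hd.1 2).1
    exact ⟨fun s => R.add_mem (R.add_mem (R.smul_mem _ h0) (R.smul_mem _ h1)) (R.smul_mem _ h2),
      R.add_mem (R.add_mem (R.smul_mem _ h0) (R.smul_mem _ h1)) (R.smul_mem _ h2)⟩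
  have ha' := hprod hPQ.left ha
  have hb' := hprod hPQ.right hb
  have hna : ∀ i, lieForm (a i) (a i) = 0 := fun i => (ha.1 i).2.2
  have hnb : ∀ i, lieForm (b i) (b i) = 0 := fun i => (hb.1 i).2.2
  have horth : ∀ u ∈ P, ∀ w ∈ Q, lieForm u w = 0 := fun u hu w hw => (hPQ.polar w).mp hw u hu
  have hpair : IsConjugatePair (conicParam a) (conicParam b) (conicDeriv a) (conicDeriv b) :=
    { continuous_a := continuous_conicParam a
      continuous_b := continuous_conicParam b
      deriv_a := hasDerivAt_conicParam a
      deriv_b := hasDerivAt_conicParam b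
      form_a := ⟨_, ha', lieForm_conicParam hna⟩
      form_b := ⟨_, hb', lieForm_conicParam hnb⟩
      aa' := lieForm_conicParam_conicDeriv hna
      bb' := lieForm_conicParam_conicDeriv hnb
      a'a' := by
        rw [lieForm_conicDeriv hna]
        exact mul_ne_zero (by norm_num) ha'
      b'b' := by
        rw [lieForm_conicDeriv hnb]
        exact mul_ne_zero (by norm_num) hb'
      ab := fun s t => horth _ ((hmem ha).1 s) _ ((hmem hb).1 t)
      a'b := fun t => horth _ (hmem ha).2 _ ((hmem hb).1 t)
      ab' := fun s => horth _ ((hmem ha).1 s) _ (hmem hb).2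
      a'b' := horth _ (hmem ha).2 _ (hmem hb).2 }
  exact hpair.hasCornerGeometry hf hns

/-! ### Spherical patches -/

lemma moebius_mem_span {M : E3hat → E3hat} {T : LieVec ≃ₗ[ℝ] LieVec}
    (hM : ∀ p, pointRep (M p) ∈ Submodule.span ℝ {T (pointRep p)}) {p : E3hat} {V : LieVec} {c : ℝ}
    (hc : c ≠ 0) (hV : pointRep p = c • V) : pointRep (M p) ∈ Submodule.span ℝ {T V} := by
  have := hM p
  rwa [hV, map_smul, Submodule.span_singleton_smul_eq (IsUnit.mk0 c hc)] at this

lemma IsMoebius.continuous {M : E3hat → E3hat} (hM : IsMoebius M) : Continuous M := by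
  obtain ⟨T, -, -, hT⟩ := hM
  have hTc : Continuous T := LinearMap.continuous_of_finiteDimensional (T : LieVec →ₗ[ℝ] LieVec)
  refine continuous_of_lift (hTc.comp continuous_normalize_pointRep) fun p => ?_
  refine moebius_mem_span hT (pointRep_weight_ne_zero p) ?_
  simp only [normalize, smul_smul, mul_inv_cancel₀ (pointRep_weight_ne_zero p), one_smul]

lemma IsMoebius.injective {M : E3hat → E3hat} (hM : IsMoebius M) : Function.Injective M := by
  obtain ⟨T, -, -, hT⟩ := hM
  intro p q hpq
  obtain ⟨c, hc, hp⟩ := exists_smul_of_mem_span (hT p)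
  obtain ⟨d, hd, hq⟩ := exists_smul_of_mem_span (hT q)
  refine eq_of_pointRep_eq_smul (c := c * d⁻¹) (T.injective ?_)
  rw [map_smul, hp, hq, hpq, smul_smul, mul_assoc, inv_mul_cancel₀ hd, mul_one]

lemma norm_sq_vec3 (a b c : ℝ) : ‖(!₂[a, b, c] : E3)‖ ^ 2 = a ^ 2 + b ^ 2 + c ^ 2 := by
  rw [EuclideanSpace.norm_sq_eq, Fin.sum_univ_three]
  simp

/-- An isometric embedding of a line is proper, hence extends continuously by `∞ ↦ ∞`. This covers
the coordinate lines that may pass through `∞`. -/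
lemma continuous_onePointMap {g : ℝ → E3} (hg : Isometry g) : Continuous (OnePoint.map g) := by
  refine OnePoint.continuous_map hg.continuous ?_
  rw [coclosedCompact_eq_cocompact, coclosedCompact_eq_cocompact]
  exact hg.isClosedEmbedding.tendsto_cocompact

lemma injective_onePointMap {g : ℝ → E3} (hg : Isometry g) : Function.Injective (OnePoint.map g) :=
  Option.map_injective hg.injective

lemma isometry_cartesian_left (b : ℝ) : Isometry fun a : ℝ => (!₂[a, b, 0] : E3) := by
  refine Isometry.of_dist_eq fun x y => ?_
  simp [EuclideanSpace.dist_eq, Fin.sum_univ_three, Real.sqrt_sq, dist_nonneg]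

lemma isometry_cartesian_right (a : ℝ) : Isometry fun b : ℝ => (!₂[a, b, 0] : E3) := by
  refine Isometry.of_dist_eq fun x y => ?_
  simp [EuclideanSpace.dist_eq, Fin.sum_univ_three, Real.sqrt_sq, dist_nonneg]

lemma isometry_polar (θ : ℝ) :
    Isometry fun r : ℝ => (!₂[r * Real.cos θ, r * Real.sin θ, 0] : E3) := by
  refine Isometry.of_dist_eq fun x y => ?_
  rw [EuclideanSpace.dist_eq, Fin.sum_univ_three, ← Real.sqrt_sq (dist_nonneg (x := x))]
  congr 1
  simp only [Real.dist_eq, sq_abs, Matrix.cons_val_zero, Matrix.cons_val_one, Matrix.cons_val]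
  linear_combination (x - y) ^ 2 * Real.sin_sq_add_cos_sq θ

lemma cartesian_coe_right (u : OnePoint ℝ) (b : ℝ) :
    cartesian u (b : OnePoint ℝ) = OnePoint.map (fun a : ℝ => (!₂[a, b, 0] : E3)) u := by
  induction u using OnePoint.rec <;> rfl

lemma cartesian_coe_left (a : ℝ) (v : OnePoint ℝ) :
    cartesian (a : OnePoint ℝ) v = OnePoint.map (fun b : ℝ => (!₂[a, b, 0] : E3)) v := by
  induction v using OnePoint.rec <;> rfl

lemma cartesian_infty_left (v : OnePoint ℝ) : cartesian OnePoint.infty v = OnePoint.infty := rfl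

lemma cartesian_infty_right (u : OnePoint ℝ) : cartesian u OnePoint.infty = OnePoint.infty := by
  induction u using OnePoint.rec <;> rfl

lemma polar_eq_map (ρ : OnePoint ℝ) (θ : ℝ) : polar ρ θ =
    OnePoint.map (fun r : ℝ => (!₂[r * Real.cos θ, r * Real.sin θ, 0] : E3)) ρ := by
  induction ρ using OnePoint.rec <;> rfl

lemma pointRep_cartesian (a b : ℝ) : pointRep (cartesian (a : OnePoint ℝ) (b : OnePoint ℝ)) =
    (1 : ℝ) • (((!₂[a, 0, 0] : E3), (1 : ℝ), a ^ 2, (0 : ℝ)) +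
      ((!₂[0, b, 0] : E3), (0 : ℝ), b ^ 2, (0 : ℝ)) : LieVec) := by
  have : cartesian (a : OnePoint ℝ) (b : OnePoint ℝ) = ((!₂[a, b, 0] : E3) : E3hat) := rfl
  rw [this, pointRep_coe, norm_sq_vec3, one_smul]
  refine Prod.ext ?_ ?_
  · ext i
    fin_cases i <;> simp
  · simp

/-- Dividing the homogeneous coordinates by `r` separates the variables: one summand depends on the
radius only, the other on the angle only. -/
lemma pointRep_polar {r : ℝ} (hr : r ≠ 0) (θ : ℝ) : pointRep (polar (r : OnePoint ℝ) θ) =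
    r • (((0 : E3), r⁻¹, r, (0 : ℝ)) +
      ((!₂[Real.cos θ, Real.sin θ, 0] : E3), (0 : ℝ), (0 : ℝ), (0 : ℝ)) : LieVec) := by
  have : polar (r : OnePoint ℝ) θ = ((!₂[r * Real.cos θ, r * Real.sin θ, 0] : E3) : E3hat) := rfl
  rw [this, pointRep_coe, norm_sq_vec3]
  refine Prod.ext ?_ ?_
  · ext i
    fin_cases i <;> simp
  · simp [hr]
    linear_combination r ^ 2 * Real.sin_sq_add_cos_sq θ

lemma hasDerivAt_vec3 {x y z : ℝ → ℝ} {x' y' z' t : ℝ} (hx : HasDerivAt x x' t)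
    (hy : HasDerivAt y y' t) (hz : HasDerivAt z z' t) :
    HasDerivAt (fun s => (!₂[x s, y s, z s] : E3)) !₂[x', y', z'] t := by
  have : HasDerivAt (fun s => ![x s, y s, z s]) ![x', y', z'] t := by
    rw [hasDerivAt_pi]
    intro i
    fin_cases i
    exacts [hx, hy, hz]
  exact (PiLp.continuousLinearEquiv 2 ℝ
    (fun _ : Fin 3 => ℝ)).symm.toContinuousLinearMap.hasFDerivAt.comp_hasDerivAt t this

lemma IsCartesianPatch.hasCornerGeometry {f : Patch} (hf : IsCartesianPatch f)
    (hns : HasNonsingularVertices f) : HasCornerGeometry f := by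
  obtain ⟨M, u, v, hM, huc, hui, hvc, hvi, hf⟩ := hf
  obtain ⟨⟨s₀, h₁⟩, ⟨s₁, h₂⟩, ⟨t₀, h₃⟩, ⟨t₁, h₄⟩⟩ := hns
  simp only [hf] at h₁ h₂ h₃ h₄
  have hfinu : ∀ s t t', M (cartesian (u s) (v t)) ≠ M (cartesian (u s) (v t')) →
      ∃ a : ℝ, (a : OnePoint ℝ) = u s := by
    intro s t t' hne
    refine OnePoint.ne_infty_iff_exists.mp fun h => hne ?_
    rw [h, cartesian_infty_left, cartesian_infty_left]
  have hfinv : ∀ t s s', M (cartesian (u s) (v t)) ≠ M (cartesian (u s') (v t)) →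
      ∃ b : ℝ, (b : OnePoint ℝ) = v t := by
    intro t s s' hne
    refine OnePoint.ne_infty_iff_exists.mp fun h => hne ?_
    rw [h, cartesian_infty_right, cartesian_infty_right]
  obtain ⟨b₀, hb₀⟩ := hfinv _ _ _ h₁
  obtain ⟨b₁, hb₁⟩ := hfinv _ _ _ h₂
  obtain ⟨a₀, ha₀⟩ := hfinu _ _ _ h₃
  obtain ⟨a₁, ha₁⟩ := hfinu _ _ _ h₄
  have hl : (fun s => f s 0) = M ∘ OnePoint.map (fun a : ℝ => (!₂[a, b₀, 0] : E3)) ∘ u := by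
    funext s
    simp only [hf, ← hb₀, cartesian_coe_right, Function.comp]
  have hr : (fun t => f 0 t) = M ∘ OnePoint.map (fun b : ℝ => (!₂[a₀, b, 0] : E3)) ∘ v := by
    funext t
    simp only [hf, ← ha₀, cartesian_coe_left, Function.comp]
  have hcl : Continuous fun s => f s 0 := by
    rw [hl]
    exact hM.continuous.comp ((continuous_onePointMap (isometry_cartesian_left b₀)).comp huc)
  have hcr : Continuous fun t => f 0 t := by
    rw [hr]
    exact hM.continuous.comp ((continuous_onePointMap (isometry_cartesian_right a₀)).comp hvc)
  have hMi := hM.injective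
  obtain ⟨T, hT, hTe, hMT⟩ := hM
  have hlift : ∀ {s t : unitInterval} {a b : ℝ}, u s = (a : OnePoint ℝ) → v t = (b : OnePoint ℝ) →
      pointRep (f s t) ∈ Submodule.span ℝ {T (((!₂[a, 0, 0] : E3), (1 : ℝ), a ^ 2, (0 : ℝ)) +
      ((!₂[0, b, 0] : E3), (0 : ℝ), b ^ 2, (0 : ℝ)))} := by
    intro s t a b hs ht
    rw [hf, hs, ht]
    exact moebius_mem_span hMT one_ne_zero (pointRep_cartesian a b)
  refine ⟨hcl, ?_, hcr, ?_, fun x hx => ?_, ?_⟩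
  · rw [hl]
    exact hMi.comp ((injective_onePointMap (isometry_cartesian_left b₀)).comp hui)
  · rw [hr]
    exact hMi.comp ((injective_onePointMap (isometry_cartesian_right a₀)).comp hvi)
  · obtain ⟨wu, hwu, hwut, hwus⟩ := exists_real_param huc hui ha₀.symm
    obtain ⟨wv, hwv, hwvt, hwvs⟩ := exists_real_param hvc hvi hb₀.symm
    have hA : HasDerivAt (fun a : ℝ => (((!₂[a, 0, 0] : E3), (1 : ℝ), a ^ 2, (0 : ℝ)) : LieVec))
        ((!₂[1, 0, 0] : E3), (0 : ℝ), 2 * a₀, (0 : ℝ)) a₀ := by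
      refine (hasDerivAt_vec3 (hasDerivAt_id' a₀) (hasDerivAt_const _ _)
        (hasDerivAt_const _ _)).prodMk ((hasDerivAt_const _ _).prodMk
        (HasDerivAt.prodMk ?_ (hasDerivAt_const _ _)))
      simpa using hasDerivAt_pow 2 a₀
    have hB : HasDerivAt (fun b : ℝ => (((!₂[0, b, 0] : E3), (0 : ℝ), b ^ 2, (0 : ℝ)) : LieVec))
        ((!₂[0, 1, 0] : E3), (0 : ℝ), 2 * b₀, (0 : ℝ)) b₀ := by
      refine (hasDerivAt_vec3 (hasDerivAt_const _ _) (hasDerivAt_id' b₀)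
        (hasDerivAt_const _ _)).prodMk ((hasDerivAt_const _ _).prodMk
        (HasDerivAt.prodMk ?_ (hasDerivAt_const _ _)))
      simpa using hasDerivAt_pow 2 b₀
    refine exists_orthogonal_tangents hT hTe hcl hcr hx hA hB (hlift ha₀.symm hb₀.symm)
      ?_ ?_ rfl rfl ?_ ?_ ?_ (hwu.mono fun s hs => hlift hs hb₀.symm)
      (hwv.mono fun t ht => hlift ha₀.symm ht) hwut hwus hwvt hwvs
    all_goals simp [lieForm, PiLp.inner_apply, Fin.sum_univ_three]
  · refine mem_circleSpan_of_add (hlift ha₀.symm hb₀.symm) (hlift ha₁.symm hb₀.symm)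
      (hlift ha₀.symm hb₁.symm) (hlift ha₁.symm hb₁.symm) ?_
    rw [← map_add, ← map_sub]
    congr 1
    abel

lemma IsPolarPatch.hasCornerGeometry {f : Patch} (hf : IsPolarPatch f)
    (hns : HasNonsingularVertices f) : HasCornerGeometry f := by
  obtain ⟨M, ρ, θ, hM, hρc, hρi, hθc, hθi, hθ, hf⟩ := hf
  obtain ⟨-, -, ⟨t₀, h₃⟩, ⟨t₁, h₄⟩⟩ := hns
  simp only [hf] at h₃ h₄
  -- The origin and `∞` lie on all lines of constant angle, so nonsingularity excludes them at the
  -- vertices. In between, `ρ` may pass through them.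
  have hfin : ∀ s t t', M (polar (ρ s) (θ t)) ≠ M (polar (ρ s) (θ t')) →
      ∃ a : ℝ, a ≠ 0 ∧ ρ s = (a : OnePoint ℝ) := by
    intro s t t' hne
    have : ∃ a : ℝ, (a : OnePoint ℝ) = ρ s := by
      refine OnePoint.ne_infty_iff_exists.mp fun h => hne ?_
      rw [h]
      rfl
    obtain ⟨a, ha⟩ := this
    refine ⟨a, ?_, ha.symm⟩
    rintro rfl
    apply hne
    rw [← ha, polar_eq_map, polar_eq_map]
    simp
  obtain ⟨a₀, ha₀, hρ₀⟩ := hfin _ _ _ h₃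
  obtain ⟨a₁, ha₁, hρ₁⟩ := hfin _ _ _ h₄
  have hl : (fun s => f s 0) = M ∘
      OnePoint.map (fun r : ℝ => (!₂[r * Real.cos (θ 0), r * Real.sin (θ 0), 0] : E3)) ∘ ρ := by
    funext s
    simp only [hf, polar_eq_map, Function.comp]
  have hr : (fun t => f 0 t) = fun t => M
      ((!₂[a₀ * Real.cos (θ t), a₀ * Real.sin (θ t), 0] : E3) : E3hat) := by
    funext t
    simp only [hf, hρ₀]
    rfl
  have hcl : Continuous fun s => f s 0 := by
    rw [hl]
    exact hM.continuous.comp ((continuous_onePointMap (isometry_polar (θ 0))).comp hρc)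
  have hcr : Continuous fun t => f 0 t := by
    rw [hr]
    refine hM.continuous.comp (OnePoint.continuous_coe.comp ?_)
    refine (PiLp.continuous_toLp 2 _).comp (continuous_pi fun i => ?_)
    fin_cases i <;> simp <;> fun_prop
  have hMi := hM.injective
  obtain ⟨T, hT, hTe, hMT⟩ := hM
  have hlift : ∀ {s t : unitInterval} {a : ℝ}, a ≠ 0 → ρ s = (a : OnePoint ℝ) →
      pointRep (f s t) ∈ Submodule.span ℝ {T (((0 : E3), a⁻¹, a, (0 : ℝ)) +
      ((!₂[Real.cos (θ t), Real.sin (θ t), 0] : E3), (0 : ℝ), (0 : ℝ), (0 : ℝ)))} := by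
    intro s t a ha hs
    rw [hf, hs]
    exact moebius_mem_span hMT ha (pointRep_polar ha _)
  refine ⟨hcl, ?_, hcr, ?_, fun x hx => ?_, ?_⟩
  · rw [hl]
    exact hMi.comp ((injective_onePointMap (isometry_polar (θ 0))).comp hρi)
  · rw [hr]
    intro t t' htt
    have h1 := OnePoint.coe_injective (hMi htt)
    have hc : a₀ * Real.cos (θ t) = a₀ * Real.cos (θ t') := by
      simpa using congrArg (fun p : E3 => p 0) h1
    have hs : a₀ * Real.sin (θ t) = a₀ * Real.sin (θ t') := by
      simpa using congrArg (fun p : E3 => p 1) h1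
    have hc' := mul_left_cancel₀ ha₀ hc
    have hs' := mul_left_cancel₀ ha₀ hs
    have hcos : Real.cos (θ t - θ t') = 1 := by
      rw [Real.cos_sub, hc', hs']
      linarith [Real.sin_sq_add_cos_sq (θ t')]
    -- A continuous injective `θ` is monotone, so its total variation is less than `2π` and equal
    -- cosines and sines force equal angles.
    have hbound : |θ t - θ t'| < 2 * Real.pi := by
      refine lt_of_le_of_lt ?_ hθ
      rcases hθc.strictMono_of_inj hθi with hmono | hanti
      · have m := hmono.monotone
        have h0 := m (unitInterval.nonneg' (t := t))
        have h0' := m (unitInterval.nonneg' (t := t'))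
        have h1 := m (unitInterval.le_one' (t := t))
        have h1' := m (unitInterval.le_one' (t := t'))
        rw [abs_of_nonneg (by linarith : 0 ≤ θ 1 - θ 0)]
        exact abs_le.mpr ⟨by linarith, by linarith⟩
      · have m := hanti.antitone
        have h0 := m (unitInterval.nonneg' (t := t))
        have h0' := m (unitInterval.nonneg' (t := t'))
        have h1 := m (unitInterval.le_one' (t := t))
        have h1' := m (unitInterval.le_one' (t := t'))
        rw [abs_of_nonpos (by linarith : θ 1 - θ 0 ≤ 0)]
        exact abs_le.mpr ⟨by linarith, by linarith⟩
    obtain ⟨hlo, hhi⟩ := abs_lt.mp hbound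
    have := (Real.cos_eq_one_iff_of_lt_of_lt hlo hhi).mp hcos
    exact hθi (sub_eq_zero.mp this)
  · obtain ⟨wu, hwu, hwut, hwus⟩ := exists_real_param hρc hρi hρ₀
    obtain ⟨wv, hwv, hwvt, hwvs⟩ := exists_real_param (OnePoint.continuous_coe.comp hθc)
      (OnePoint.coe_injective.comp hθi) (σ := θ 0) rfl
    have hwv' : ∀ᶠ t in 𝓝[>] 0, wv t = θ t :=
      hwv.mono fun t ht => (OnePoint.coe_injective ht).symm
    have hA : HasDerivAt (fun a : ℝ => (((0 : E3), a⁻¹, a, (0 : ℝ)) : LieVec))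
        ((0 : E3), -(a₀ ^ 2)⁻¹, (1 : ℝ), (0 : ℝ)) a₀ :=
      (hasDerivAt_const _ _).prodMk ((hasDerivAt_inv ha₀).prodMk
        ((hasDerivAt_id' a₀).prodMk (hasDerivAt_const _ _)))
    have hB : HasDerivAt (fun r : ℝ =>
        (((!₂[Real.cos r, Real.sin r, 0] : E3), (0 : ℝ), (0 : ℝ), (0 : ℝ)) : LieVec))
        ((!₂[-Real.sin (θ 0), Real.cos (θ 0), 0] : E3), (0 : ℝ), (0 : ℝ), (0 : ℝ)) (θ 0) :=
      (hasDerivAt_vec3 (Real.hasDerivAt_cos _) (Real.hasDerivAt_sin _)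
        (hasDerivAt_const _ _)).prodMk (hasDerivAt_const _ _)
    refine exists_orthogonal_tangents hT hTe hcl hcr hx hA hB (hlift ha₀ hρ₀)
      ?_ ?_ rfl rfl ?_ ?_ ?_ ?_ ?_ hwut hwus hwvt hwvs
    · simp [lieForm]
      field_simp
      ring
    · simp [lieForm, PiLp.inner_apply, Fin.sum_univ_three]
      ring
    · simp [lieForm]
      exact ha₀
    · refine ne_of_eq_of_ne (b := (1 : ℝ)) ?_ one_ne_zero
      simp only [lieForm, real_inner_self_eq_norm_sq, norm_sq_vec3]
      linear_combination Real.sin_sq_add_cos_sq (θ 0)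
    · simp [lieForm]
    · filter_upwards [hwu, hwut.eventually_ne ha₀] with s hs hs'
      exact hlift hs' hs
    · filter_upwards [hwv'] with t ht
      rw [ht]
      exact hlift ha₀ hρ₀
  · refine mem_circleSpan_of_add (hlift ha₀ hρ₀) (hlift ha₁ hρ₁) (hlift ha₀ hρ₀)
      (hlift ha₁ hρ₁) ?_
    rw [← map_add, ← map_sub]
    congr 1
    abel

theorem IsCyclidicPatch.hasCornerGeometry {f : Patch} (hf : IsCyclidicPatch f)
    (hns : HasNonsingularVertices f) : HasCornerGeometry f := by
  rcases hf with hf | hf | hf | hf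
  · exact hf.hasCornerGeometry hns
  · exact hf.hasCornerGeometry hns
  · exact hf.hasCornerGeometry hns
  · exact (hf.hasCornerGeometry hns.swap).swap

/-! ## Three patches determine a cyclidic cube -/

lemma HasEmbeddedFaces.isSphericalCube {X : CubeVertex → E3} (h : HasEmbeddedFaces X) :
    IsSphericalCube X := fun S i j hi hj hij => by
  obtain ⟨-, K, hK, hsub, -⟩ := h S i j hi hj hij
  exact ⟨K, hK, hsub⟩

lemma cubeVertex_cases (S : CubeVertex) (hS : S ≠ Finset.univ) :
    S = ∅ ∨ S = {0} ∨ S = {1} ∨ S = {2} ∨ S = {1, 2} ∨ S = {2, 0} ∨ S = {0, 1} := by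
  revert S
  decide

lemma Concircular.mono {S S' : Set E3hat} (h : S ⊆ S') (hS' : Concircular S') : Concircular S := by
  obtain ⟨K, hK, hsub⟩ := hS'
  exact ⟨K, hK, h.trans hsub⟩

lemma AreThreeFaces.isCorner {f : Fin 3 → Patch} {X : CubeVertex → E3} (hF : AreThreeFaces f X)
    (hnc : ¬ Concircular {p | ∃ S : CubeVertex, S ≠ Finset.univ ∧ p = X S}) :
    IsCorner (X ∅ : E3hat) (X {0} : E3hat) (X {1} : E3hat) (X {2} : E3hat) (X {1, 2} : E3hat)
      (X {2, 0} : E3hat) (X {0, 1} : E3hat) := by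
  have hne : ∀ {a b : E3}, a ≠ b → (a : E3hat) ≠ b := fun h => OnePoint.coe_injective.ne h
  have hd : ∀ {a b c d : E3}, [a, b, c, d].Nodup → (a : E3hat) ≠ b ∧ (a : E3hat) ≠ c ∧
      (a : E3hat) ≠ d ∧ (b : E3hat) ≠ c ∧ (b : E3hat) ≠ d ∧ (c : E3hat) ≠ d := by
    intro a b c d h
    obtain ⟨h1, h2, h3, h4, h5, h6⟩ := nodup_four h
    exact ⟨hne h1, hne h2, hne h3, hne h4, hne h5, hne h6⟩
  obtain ⟨p1, p2, p3, p4, p5, p6⟩ := hd (hF.distinct 0)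
  obtain ⟨q1, q2, q3, q4, q5, q6⟩ := hd (hF.distinct 1)
  obtain ⟨r1, r2, r3, r4, r5, r6⟩ := hd (hF.distinct 2)
  have hpl : ∀ i, pointRep (X {i + 1, i + 2} : E3hat) ∈
      circleSpan (X ∅ : E3hat) (X {i + 1} : E3hat) (X {i + 2} : E3hat) := by
    intro i
    have := ((hF.patch i).hasCornerGeometry (hF.nonsingular i)).planar
    rwa [hF.vertex, hF.vertex_left, hF.vertex_opposite, hF.vertex_right] at this
  refine ⟨r1, p1, q1, r5, p5, q5, p2.symm, q2.symm, r2.symm, p4.symm, p6, q4.symm, q6, r4.symm, r6,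
    hpl 0, hpl 1, hpl 2, fun h => hnc (h.mono ?_)⟩
  rintro _ ⟨S, hS, rfl⟩
  rcases cubeVertex_cases S hS with rfl | rfl | rfl | rfl | rfl | rfl | rfl <;> simp

lemma isEighthVertex_iff {X : CubeVertex → E3} {p : E3hat} : IsEighthVertex X p ↔
    Concircular {(X {0} : E3hat), (X {0, 1} : E3hat), p, (X {2, 0} : E3hat)} ∧
    Concircular {(X {1} : E3hat), (X {1, 2} : E3hat), p, (X {0, 1} : E3hat)} ∧
    Concircular {(X {2} : E3hat), (X {2, 0} : E3hat), p, (X {1, 2} : E3hat)} := by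
  have e0 : ({0, 0 + 2} : CubeVertex) = {2, 0} := by decide
  have e1 : ({1, 1 + 2} : CubeVertex) = {0, 1} := by decide
  have e2 : ({2, 2 + 2} : CubeVertex) = {1, 2} := by decide
  constructor
  · intro h
    have h0 := h 0
    have h1 := h 1
    have h2 := h 2
    rw [e0] at h0
    rw [e1] at h1
    rw [e2] at h2
    exact ⟨h0, h1, h2⟩
  · rintro ⟨h0, h1, h2⟩ i
    rw [← e0] at h0
    rw [← e1] at h1
    rw [← e2] at h2
    fin_cases i
    exacts [h0, h1, h2]

/-- The common tangent vectors of three patches form an orthonormal frame. -/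
lemma AreThreeFaces.exists_frame {f : Fin 3 → Patch} {X : CubeVertex → E3}
    (hF : AreThreeFaces f X) : ∃ b : Fin 3 → E3, Orthonormal ℝ b ∧
      (∀ i, IsInitialTangent (fun s => f i s 0) (b (i + 1))) ∧
      ∀ i, IsInitialTangent (fun t => f i 0 t) (b (i + 2)) := by
  have hG := fun i => (hF.patch i).hasCornerGeometry (hF.nonsingular i)
  choose l r hl hr hlr using fun i => (hG i).tangents (X ∅) (hF.vertex i)
  -- Initial tangents depend only on the arc, so they agree on the arc shared by `f i` and `f (i +
  -- 1)`.
  have hglue : ∀ i, l (i + 1) = r i := fun i =>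
    (hl (i + 1)).unique ((hr i).of_range_eq (hG i).continuous_right (hG i).injective_right
      (hG (i + 1)).continuous_left (hG (i + 1)).injective_left
      ((hF.vertex i).trans (hF.vertex (i + 1)).symm) (hF.arc i))
  have e1 : ∀ i : Fin 3, i + 1 + 2 = i := by decide
  have e2 : ∀ i : Fin 3, i + 2 + 2 = i + 1 := by decide
  have hb : ∀ i, inner ℝ (l i) (l (i + 1)) = 0 := fun i => by rw [hglue, hlr]
  -- Direction `k` is the left direction of the patch `f (k + 2)`, as `k + 2 + 1 = k` modulo 3.
  refine ⟨fun k => l (k + 2), ⟨fun k => ?_, fun j k hjk => ?_⟩, fun i => ?_, fun i => ?_⟩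
  · obtain ⟨-, -, -, hn, -⟩ := hl (k + 2)
    exact hn
  · simp only
    have : k + 2 = j + 2 + 1 ∨ j + 2 = k + 2 + 1 := by
      revert j k
      decide
    rcases this with h | h
    · rw [h]
      exact hb _
    · rw [h, real_inner_comm]
      exact hb _
  · simp only [e1]
    exact hl i
  · simp only [e2, hglue]
    exact hr i

/-- The patches prescribe seven vertices and the frame at `X ∅`. The eighth vertex is forced by
concircularity, and all other frames by the homeomorphism with the orthonormal frames. -/
theorem AreThreeFaces.existsUnique_cube {f : Fin 3 → Patch} {X : CubeVertex → E3}
    (hF : AreThreeFaces f X) {q : E3} (hq : ∀ r : E3, IsEighthVertex X r → r = q)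
    (hE : HasEmbeddedFaces (Function.update X Finset.univ q)) :
    ∃! C : (CubeVertex → E3) × (CubeVertex → Fin 3 → E3), IsCubeWithFaces f C.1 C.2 := by
  obtain ⟨b, hb, hl, hr⟩ := hF.exists_frame
  have hY : ∀ S, S ≠ Finset.univ → Function.update X Finset.univ q S = X S := fun S hS =>
    Function.update_of_ne hS _ _
  have hYq : Function.update X Finset.univ q Finset.univ = q := Function.update_self _ _ _
  generalize Function.update X Finset.univ q = Y at *
  have h0 : Y ∅ = X ∅ := hY _ (by decide)
  have h1 : ∀ i : Fin 3, Y {i} = X {i} := fun i => hY _ (by decide +revert)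
  have h2 : ∀ i j : Fin 3, Y {i, j} = X {i, j} := fun i j => hY _ (by decide +revert)
  obtain ⟨e, he⟩ := exists_homeomorph_frames hE.isSphericalCube hE ∅
  refine ⟨(Y, (e.symm ⟨b, hb⟩).1), ?_, ?_⟩
  · have heb : (e.symm ⟨b, hb⟩).1 ∅ = b := by
      rw [← he, Homeomorph.apply_symm_apply]
    refine ⟨(e.symm ⟨b, hb⟩).2, ?_, ?_, ?_, ?_, ?_, ?_⟩
    · exact fun i => (hF.vertex i).trans (congrArg OnePoint.some h0.symm)
    · exact fun i => (hF.vertex_left i).trans (congrArg OnePoint.some (h1 _).symm)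
    · exact fun i => (hF.vertex_opposite i).trans (congrArg OnePoint.some (h2 _ _).symm)
    · exact fun i => (hF.vertex_right i).trans (congrArg OnePoint.some (h1 _).symm)
    · exact fun i => by
        simp only [heb]
        exact hl i
    · exact fun i => by
        simp only [heb]
        exact hr i
  · rintro ⟨Z, B⟩ hC
    simp only at hC
    have z0 : Z ∅ = X ∅ := OnePoint.coe_injective ((hC.vertex 0).symm.trans (hF.vertex 0))
    have z1 : ∀ i : Fin 3, Z {i} = X {i} := by
      intro i
      have e1 : i + 2 + 1 = i := by decide +revert
      have := OnePoint.coe_injective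
        ((hC.vertex_left (i + 2)).symm.trans (hF.vertex_left (i + 2)))
      rwa [e1] at this
    have z2 : ∀ i : Fin 3, Z {i + 1, i + 2} = X {i + 1, i + 2} := fun i =>
      OnePoint.coe_injective ((hC.vertex_opposite i).symm.trans (hF.vertex_opposite i))
    have z2' : ∀ i j : Fin 3, i ≠ j → Z {i, j} = X {i, j} := by
      intro i j hij
      have : ∃ k : Fin 3, ({i, j} : CubeVertex) = {k + 1, k + 2} := by
        revert i j
        decide
      obtain ⟨k, hk⟩ := this
      rw [hk, z2]
    -- The three faces of a competing cube that meet at the last vertex are exactly the circles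
    -- defining an eighth vertex.
    have z3 : Z Finset.univ = q := by
      have e1 : ∀ i : Fin 3, (insert (i + 1) {i} : CubeVertex) = {i, i + 1} := by decide
      have e2 : ∀ i : Fin 3, (insert (i + 2) {i} : CubeVertex) = {i, i + 2} := by decide
      have e3 : ∀ i : Fin 3, (insert (i + 1) {i, i + 2} : CubeVertex) = Finset.univ := by decide
      have n1 : ∀ i : Fin 3, i ≠ i + 1 := by decide
      have n2 : ∀ i : Fin 3, i ≠ i + 2 := by decide
      refine hq _ fun i => ?_
      have := hC.cube.spherical {i} (i + 1) (i + 2) (by decide +revert) (by decide +revert)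
        (by decide +revert)
      rw [e2, e1, e3, z1, z2' i (i + 1) (n1 i), z2' i (i + 2) (n2 i)] at this
      exact this
    have hZ : Z = Y := by
      funext S
      by_cases hS : S = Finset.univ
      · rw [hS, z3, hYq]
      · rw [hY S hS]
        rcases cubeVertex_cases S hS with rfl | rfl | rfl | rfl | rfl | rfl | rfl
        exacts [z0, z1 0, z1 1, z1 2, z2 0, z2 1, z2 2]
    subst hZ
    -- Uniqueness of initial tangents; every direction `k` occurs as the left direction of `f (k +
    -- 2)`.
    have hB : B ∅ = b := by
      funext k
      have e1 : k + 2 + 1 = k := by decide +revert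
      have := (hC.tangent_left (k + 2)).unique (hl (k + 2))
      rwa [e1] at this
    have : (⟨B, hC.cube⟩ : CyclidicCubesOn Z) = e.symm ⟨b, hb⟩ := by
      rw [Homeomorph.eq_symm_apply]
      exact Subtype.ext ((he _).trans hB)
    rw [← this]

end Cyclidic

end

theorem mainTheorem10 :
    -- cyclidic cubes with the vertices of a given spherical cube
    (∀ X : Cyclidic.CubeVertex → Cyclidic.E3,
      Cyclidic.IsSphericalCube X → Cyclidic.HasEmbeddedFaces X →
        -- evaluation at any vertex is a bijection (even a homeomorphism) onto orthonormal frames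
        (∀ S : Cyclidic.CubeVertex,
          ∃ e : Cyclidic.CyclidicCubesOn X ≃ₜ Cyclidic.OrthonormalFrames,
            ∀ B : Cyclidic.CyclidicCubesOn X,
              (e B : Fin 3 → Cyclidic.E3) = (B : Cyclidic.CubeVertex → Fin 3 → Cyclidic.E3) S) ∧
        -- the family has three parameters
        ∀ B : Cyclidic.CyclidicCubesOn X,
          ∃ φ : OpenPartialHomeomorph (Cyclidic.CyclidicCubesOn X) (EuclideanSpace ℝ (Fin 3)),
            B ∈ φ.source) ∧
    -- three cyclidic patches determine a cyclidic cube
    (∀ (f : Fin 3 → Cyclidic.Patch) (X : Cyclidic.CubeVertex → Cyclidic.E3),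
      Cyclidic.AreThreeFaces f X →
      ¬ Cyclidic.Concircular {p | ∃ S : Cyclidic.CubeVertex, S ≠ Finset.univ ∧ p = X S} →
        ∃ p : Cyclidic.E3hat, Cyclidic.IsEighthVertex X p ∧
          (∀ q : Cyclidic.E3hat, Cyclidic.IsEighthVertex X q → q = p) ∧
          ∀ q : Cyclidic.E3, p = (q : Cyclidic.E3hat) →
            Cyclidic.HasEmbeddedFaces (Function.update X Finset.univ q) →
              ∃! C : (Cyclidic.CubeVertex → Cyclidic.E3) ×
                  (Cyclidic.CubeVertex → Fin 3 → Cyclidic.E3),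
                Cyclidic.IsCubeWithFaces f C.1 C.2) := by
  refine ⟨fun X hX hE => ⟨Cyclidic.exists_homeomorph_frames hX hE, fun B => ?_⟩,
    fun f X hF hnc => ?_⟩
  · obtain ⟨e, -⟩ := Cyclidic.exists_homeomorph_frames hX hE ∅
    obtain ⟨φ, hφ⟩ := Cyclidic.exists_chart_frames (e B)
    -- The Cayley chart around the frame at `∅`, pulled back along the evaluation homeomorphism.
    refine ⟨e.toOpenPartialHomeomorph.trans φ, ?_⟩
    simpa using hφ
  · obtain ⟨p, hp, hup⟩ := (hF.isCorner hnc).existsUnique_eighth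
    refine ⟨p, Cyclidic.isEighthVertex_iff.mpr hp,
      fun q hq => hup q (Cyclidic.isEighthVertex_iff.mp hq), ?_⟩
    rintro q rfl hE
    exact hF.existsUnique_cube (fun r hr =>
      OnePoint.coe_injective (hup r (Cyclidic.isEighthVertex_iff.mp hr))) hE
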